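/- Let $d\in\{2,3\}$ and let $\Omega\subset\mathbb{R}^d$ be a convex polyhedral (polygonal) domain. Let $\Gamma_C\subset\Gamma_D\subset\partial\Omega$, put $\Gamma_C':=\partial\Omega\setminus\Gamma_C$ and $\Gamma_D':=\partial\Omega\setminus\Gamma_D$, and assume that $\Gamma_C,\Gamma_D,\Gamma_D'$ have positive $(d-1)$-dimensional measure. Let $\mathcal{T}_h$ be a finite conforming mesh of $\overline\Omega$ into nondegenerate closed simplices (any two of them meet in the simplex spanned by their common vertices, possibly empty), fitted to $\Gamma_C$ and $\Gamma_D$: the relative interior of each boundary face is contained in $\Gamma$ or disjoint from it, for $\Gamma\in\{\Gamma_C,\Gamma_D\}$. Let $\mathcal{F}_i$ be the set of interior faces and, for $\Gamma\subset\partial\Omega$, let $\mathcal{F}_\Gamma$ be the set of faces whose relative interior lies in $\Gamma$; put $h_F:=\operatorname{diam}F$. On an interior face let $[v]$ denote the difference of the traces of $v$ from the two sides (in an arbitrary fixed order), on a boundary face the trace of $v$. Define $$X_h^{\Gamma}:=\Big\{v_h\in L^2(\Omega): v_h|_\kappa\in\mathbb{P}_1(\kappa)\ \forall\kappa\in\mathcal{T}_h,\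 \int_F[v_h]\,ds=0\ \forall F\in\mathcal{F}_i\cup\mathcal{F}_\Gamma\Big\},$$ $V_h:=X_h^{\Gamma_D}$ and $W_h:=X_h^{\Gamma_C'}$. For $\gamma_V,\gamma_W>0$ let $$a_h(u,w):=\sum_{\kappa\in\mathcal{T}_h}\int_\kappa\nabla u\cdot\nabla w\,dx,\qquad s_V(u,v):=\sum_{F\in\mathcal{F}_i\cup\mathcal{F}_{\Gamma_D}}\int_F\gamma_Vh_F^{-1}[u][v]\,ds,$$ and let $s_W$ be either of the two forms $$s_W(z,w):=\sum_{\kappa\in\mathcal{T}_h}\int_\kappa\gamma_W\nabla z\cdot\nabla w\,dx\qquad\text{or}\qquad s_W(z,w):=\sum_{F\in\mathcal{F}_i\cup\mathcal{F}_{\Gamma_C'}}\int_F\gamma_Wh_F^{-1}[z][w]\,ds .$$ Let $f\in L^2(\Omega)$, $\psi\in L^2(\Gamma_C)$ and $l(w):=\int_\Omega fw\,dx+\int_{\Gamma_C}\psi w\,ds$. Then, for each of the two choices of $s_W$, there is exactly one pair $(u_h,z_h)\in V_h\times W_h$ such that $$a_h(u_h,w_h)-s_W(z_h,w_h)=l(w_h),\qquad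 a_h(v_h,z_h)+s_V(u_h,v_h)=0\qquad\text{for all }(v_h,w_h)\in V_h\times W_h .$$ -/

import Mathlib

open MeasureTheory Set
open scoped MeasureTheory

noncomputable section

namespace CauchyFEM

/-- The Euclidean space `ℝ^d`. -/
abbrev Space (d : ℕ) : Type := EuclideanSpace ℝ (Fin d)

/-- The closed simplex spanned by a finite set of vertices. -/
abbrev hull {d : ℕ} (s : Finset (Space d)) : Set (Space d) := convexHull ℝ (s : Set (Space d))

/-- A finite conforming simplicial mesh of `Ω ⊆ ℝ^d`: a finite geometric simplicial complex, all of
whose simplices are faces of `d`-dimensional simplices, and which covers the closure of `Ω`.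
(Affine independence of the vertices, and the fact that two simplices meet in the simplex spanned
by their common vertices, are part of `Geometry.SimplicialComplex`.) -/
structure Mesh {d : ℕ} (Ω : Set (Space d)) extends Geometry.SimplicialComplex ℝ (Space d) where
  finite_faces : faces.Finite
  pure_dim : ∀ s ∈ faces, ∃ t ∈ faces, s ⊆ t ∧ t.card = d + 1
  space_eq : toSimplicialComplex.space = closure Ω

namespace Mesh

variable {d : ℕ} {Ω : Set (Space d)} (T : Mesh Ω)

open Classical in
/-- The elements `κ` of the mesh: its `d`-dimensional simplices, given by their vertex sets. -/
def elements : Finset (Finset (Space d)) :=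
  T.finite_faces.toFinset.filter fun s => s.card = d + 1

open Classical in
/-- The element faces `F` of the mesh: its `(d-1)`-dimensional simplices. -/
def elementFaces : Finset (Finset (Space d)) :=
  T.finite_faces.toFinset.filter fun s => s.card = d

/-- `(κ, κ')` are two different elements sharing the face `F`. -/
def IsSides (F : Finset (Space d)) (p : T.elements × T.elements) : Prop :=
  p.1 ≠ p.2 ∧ F ⊆ p.1.1 ∧ F ⊆ p.2.1

open Classical in
/-- The interior faces: those shared by two different elements. -/
def interiorFaces : Finset (Finset (Space d)) :=
  T.elementFaces.filter fun F => ∃ p, T.IsSides F p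

open Classical in
/-- The faces lying in a part `Γ` of the boundary. They are compared with `Γ` through their relative
interior, so that it does not matter which of the points of the interface between `Γ` and the
remaining part of the boundary belong to `Γ`. -/
def facesIn (Γ : Set (Space d)) : Finset (Finset (Space d)) :=
  T.elementFaces.filter fun F => intrinsicInterior ℝ (hull F) ⊆ Γ

/-- The mesh is fitted to the part `Γ` of the boundary: the relative interior of every boundary face
lies in `Γ` or in the complement of `Γ`. -/
def FittedTo (Γ : Set (Space d)) : Prop :=
  ∀ F ∈ T.elementFaces, hull F ⊆ frontier Ω →
    intrinsicInterior ℝ (hull F) ⊆ Γ ∨ Disjoint (intrinsicInterior ℝ (hull F)) Γ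

/-- Piecewise affine functions `v_h`, without any continuity: one affine polynomial
`v_h|_κ ∈ ℙ₁(κ)` for every element `κ`. (An affine function on the nondegenerate simplex `κ` is the
restriction of exactly one affine function on `ℝ^d`, so these are exactly the functions in
`L²(Ω)` that agree almost everywhere on each element with an affine polynomial.) -/
abbrev BrokenP1 : Type := T.elements → (Space d →ᵃ[ℝ] ℝ)

open Classical in
/-- The jump `[v]` at a point `x` of the face `F`: on an interior face the difference of the traces
from the two sides, in an arbitrary but fixed order; on a boundary face the trace itself. -/
def jump (F : Finset (Space d)) (v : T.BrokenP1) (x : Space d) : ℝ :=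
  if h : ∃ p, T.IsSides F p then v h.choose.1 x - v h.choose.2 x
  else if h : ∃ κ : T.elements, F ⊆ κ.1 then v h.choose x
  else 0

/-- The integral of `g` over the face `F` with respect to the `(d-1)`-dimensional surface measure. -/
def faceIntegral (F : Finset (Space d)) (g : Space d → ℝ) : ℝ :=
  ∫ x in hull F, g x ∂(μHE[d - 1] : Measure (Space d))

open Classical in
/-- The Crouzeix–Raviart space `X_h^Γ`: piecewise affine functions whose jumps have mean value zero
on all interior faces and on all faces in `Γ`. -/
def crouzeixRaviart (Γ : Set (Space d)) : Set T.BrokenP1 :=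
  {v | ∀ F ∈ T.interiorFaces ∪ T.facesIn Γ, faceIntegral F (T.jump F v) = 0}

/-- `∑_κ ∫_κ ∇u · ∇w dx`. -/
def aForm (u w : T.BrokenP1) : ℝ :=
  ∑ κ : T.elements, ∫ x in hull κ.1, inner ℝ (gradient (u κ) x) (gradient (w κ) x)

open Classical in
/-- The jump penalty `∑_{F ∈ F_i ∪ F_Γ} ∫_F γ h_F⁻¹ [u] [v] ds`, with `h_F = diam F`. -/
def jumpForm (Γ : Set (Space d)) (γ : ℝ) (u v : T.BrokenP1) : ℝ :=
  ∑ F ∈ T.interiorFaces ∪ T.facesIn Γ,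
    faceIntegral F fun x => γ * (Metric.diam (hull F))⁻¹ * T.jump F u x * T.jump F v x

/-- The gradient stabilization `∑_κ ∫_κ γ ∇z · ∇w dx`. -/
def gradForm (γ : ℝ) (z w : T.BrokenP1) : ℝ :=
  ∑ κ : T.elements, ∫ x in hull κ.1, γ * inner ℝ (gradient (z κ) x) (gradient (w κ) x)

/-- The functional `l(w) = ∫_Ω f w dx + ∫_{Γ_C} ψ w ds`, evaluated element by element and face by
face. (On a boundary face the jump of `w` is its trace.) -/
def load (ΓC : Set (Space d)) (f ψ : Space d → ℝ) (w : T.BrokenP1) : ℝ :=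
  (∑ κ : T.elements, ∫ x in hull κ.1, f x * w κ x) +
    ∑ F ∈ T.facesIn ΓC, faceIntegral F fun x => ψ x * T.jump F w x

/-- `(u_h, z_h)` solves the stabilized discrete formulation on `V_h × W_h`, where
`V_h = X_h^{Γ_D}`, `W_h = X_h^{∂Ω \ Γ_C}`, with adjoint stabilization `sW`. -/
def IsDiscreteSolution (ΓD ΓC : Set (Space d)) (γV : ℝ) (sW : T.BrokenP1 → T.BrokenP1 → ℝ)
    (f ψ : Space d → ℝ) (p : T.BrokenP1 × T.BrokenP1) : Prop :=
  p.1 ∈ T.crouzeixRaviart ΓD ∧ p.2 ∈ T.crouzeixRaviart (frontier Ω \ ΓC) ∧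
    (∀ w ∈ T.crouzeixRaviart (frontier Ω \ ΓC), T.aForm p.1 w - sW p.2 w = T.load ΓC f ψ w) ∧
    ∀ v ∈ T.crouzeixRaviart ΓD, T.aForm v p.2 + T.jumpForm ΓD γV p.1 v = 0

end Mesh

end CauchyFEM

end

/-!
The discrete problem is a square linear system on the finite dimensional space `V_h × W_h`
(`existsUnique_saddlePoint`), so it suffices to show that the homogeneous problem has only the
trivial solution. Testing the homogeneous problem with `(u_h, z_h)` itself gives
`s_V(u_h, u_h) + s_W(z_h, z_h) = 0`. Hence both stabilizations vanish, which makes `u_h` and `z_h`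
continuous, with `u_h = 0` on `Γ_D` and `z_h = 0` on `∂Ω \ Γ_C`, and what remains is
`a_h(u_h, w) = 0` on `W_h` and `a_h(v, z_h) = 0` on `V_h`.

The heart of the matter is a discrete unique continuation principle
(`Mesh.eq_zero_of_aForm_eq_zero`). Let `v` be continuous and piecewise affine, and `a_h`-orthogonal
to the Crouzeix–Raviart space `X_h^Γ`. The basis function `Mesh.crFun` of an interior face tests the
jump of the normal derivative of `v` across the face; it vanishes, the tangential derivative is
continuous anyway, so `v` is the same affine function on both sides (`Mesh.eq_of_aForm_crFun`).
Since any two elements are connected through common faces (`Mesh.eq_of_forall_shared_face`), `v` is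
affine on `Ω`. On a boundary face outside `Γ` the basis function is admissible too, so the normal
derivative of `v` vanishes there; if `v` vanishes on this face as well, then `v = 0`. For `u_h` such
a face is found in `Γ_C`, for `z_h` in `∂Ω \ Γ_D` (`Mesh.exists_boundaryFace`).

The geometric input is that two elements with a common face lie on opposite sides of it
(`Mesh.faceCoord_neg`), that their volumes are proportional to their heights over it
(`Mesh.volume_hull_eq`), and that a face in the boundary of the convex domain belongs to one element
only (`Mesh.not_hull_subset_frontier`). Integrals over faces are computed in an isometric chart
(`exists_chart`), where the mean value of an affine function is the average of its vertex values
(`setIntegral_affineMap`).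
-/

open MeasureTheory Set
open scoped MeasureTheory

noncomputable section

namespace CauchyFEM

/-! ### Shears and integrals over a simplex -/

section Shear

variable {E : Type*} [NormedAddCommGroup E] [NormedSpace ℝ E]

/-- The affine map `x ↦ x + φ(x) v`, which fixes the hyperplane `φ = 0` pointwise. -/
def shear (φ : E →ᵃ[ℝ] ℝ) (v : E) : E →ᵃ[ℝ] E where
  toFun x := x + φ x • v
  linear := LinearMap.transvection φ.linear v
  map_vadd' p w := by
    have h : φ (w + p) = φ.linear w + φ p := φ.map_vadd p w
    simp only [vadd_eq_add, LinearMap.transvection.apply, h, add_smul]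
    abel

theorem shear_apply (φ : E →ᵃ[ℝ] ℝ) (v x : E) : shear φ v x = x + φ x • v := rfl

variable [FiniteDimensional ℝ E] [MeasurableSpace E] [BorelSpace E]
  (μ : Measure E) [μ.IsAddHaarMeasure]

/-- A shear is, up to a translation, the transvection `x ↦ x + φ(x) v` with the linear part of `φ`,
so its determinant is `1 + φ(v)`. -/
theorem addHaar_image_shear (φ : E →ᵃ[ℝ] ℝ) (v : E) (s : Set E) :
    μ (shear φ v '' s) = ENNReal.ofReal |1 + φ.linear v| * μ s := by
  have h : shear φ v '' s =
      (fun x => φ 0 • v + x) '' (LinearMap.transvection φ.linear v '' s) := by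
    rw [image_image]
    refine image_congr fun x _ => ?_
    have hx : φ x = φ.linear x + φ 0 := congrFun φ.decomp x
    simp only [shear_apply, LinearMap.transvection.apply, hx, add_smul]
    abel
  rw [h, image_add_left, measure_preimage_add, Measure.addHaar_image_linearMap,
    LinearMap.transvection.det]

theorem setIntegral_image_shear (φ : E →ᵃ[ℝ] ℝ) (v : E) {s : Set E} (hs : MeasurableSet s)
    (h : |1 + φ.linear v| = 1) (g : E → ℝ) :
    ∫ x in shear φ v '' s, g x ∂μ = ∫ x in s, g (shear φ v x) ∂μ := by
  have hder : ∀ x, HasFDerivAt (shear φ v) (shear φ v).linear.toContinuousLinearMap x :=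
    fun x => by
      have := ((shear φ v).linear.toContinuousLinearMap.hasFDerivAt (x := x)).add_const
        (shear φ v 0)
      refine this.congr_of_eventuallyEq (Filter.Eventually.of_forall fun y => ?_)
      exact congrFun (shear φ v).decomp y
  have hinj : Function.Injective (shear φ v) := by
    intro x y hxy
    have hφ : φ x - φ y = φ.linear (x - y) := by
      have hl := φ.linearMap_vsub x y
      simp only [vsub_eq_sub] at hl
      exact hl.symm
    have h0 : (x - y) + (φ x - φ y) • v = 0 := by
      have : x + φ x • v - (y + φ y • v) = 0 := sub_eq_zero.2 hxy
      rw [sub_smul, ← this]; abel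
    have h1 : (φ x - φ y) * (1 + φ.linear v) = 0 := by
      have := congrArg φ.linear h0
      simp only [map_add, map_smul, ← hφ, map_zero, smul_eq_mul] at this
      linear_combination this
    have h2 : 1 + φ.linear v ≠ 0 := by
      intro h3; simp [h3] at h
    have h3 := (mul_eq_zero.1 h1).resolve_right h2
    simpa [h3, sub_eq_zero] using h0
  rw [integral_image_eq_integral_abs_det_fderiv_smul μ hs
    (fun x _ => (hder x).hasFDerivWithinAt) hinj.injOn]
  have hdet : (shear φ v).linear.toContinuousLinearMap.det = 1 + φ.linear v :=
    LinearMap.transvection.det φ.linear v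
  simp [hdet, h]

end Shear

theorem isClosed_convexHull_range {ι E : Type*} [Finite ι] [NormedAddCommGroup E]
    [NormedSpace ℝ E] (b : ι → E) : IsClosed (convexHull ℝ (range b)) :=
  (finite_range b).isClosed_convexHull ℝ

section Simplex

variable {E ι : Type*} [NormedAddCommGroup E] [NormedSpace ℝ E] [Fintype ι]
  (b : AffineBasis ι ℝ E)

theorem affineMap_eq_sum_coord (g : E →ᵃ[ℝ] ℝ) (x : E) :
    g x = ∑ i, b.coord i x * g (b i) := by
  conv_lhs => rw [← b.affineCombination_coord_eq_self x,
    Finset.map_affineCombination _ _ _ (b.sum_coord_apply_eq_one x),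
    Finset.affineCombination_eq_linear_combination _ _ _ (b.sum_coord_apply_eq_one x)]
  simp

theorem interior_simplex_nonempty : (interior (convexHull ℝ (range b))).Nonempty := by
  have := b.finiteDimensional
  rw [interior_convexHull_nonempty_iff_affineSpan_eq_top]
  exact b.tot

variable [MeasurableSpace E] (μ : Measure E) [μ.IsAddHaarMeasure]

theorem measure_simplex_pos : 0 < μ (convexHull ℝ (range b)) :=
  (isOpen_interior.measure_pos μ (interior_simplex_nonempty b)).trans_le
    (measure_mono interior_subset)

theorem measure_simplex_lt_top : μ (convexHull ℝ (range b)) < ⊤ :=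
  ((finite_range b).isCompact_convexHull ℝ).measure_lt_top

variable [BorelSpace E]

theorem integrableOn_simplex {g : E → ℝ} (hg : Continuous g) :
    IntegrableOn g (convexHull ℝ (range b)) μ :=
  hg.continuousOn.integrableOn_compact ((finite_range b).isCompact_convexHull ℝ)

variable [FiniteDimensional ℝ E]

/-- The affine reflection that swaps two vertices of a simplex preserves volume, so that all
barycentric coordinates have the same integral. -/
theorem setIntegral_coord_eq (i j : ι) :
    ∫ x in convexHull ℝ (range b), b.coord i x ∂μ =
      ∫ x in convexHull ℝ (range b), b.coord j x ∂μ := by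
  classical
  rcases eq_or_ne i j with rfl | hij
  · rfl
  set φ : E →ᵃ[ℝ] ℝ := b.coord i - b.coord j
  set v := b j - b i
  have hb : ∀ k, shear φ v (b k) = b (Equiv.swap i j k) := by
    intro k
    simp only [shear_apply, φ, v, AffineMap.coe_sub, Pi.sub_apply, AffineBasis.coord_apply]
    rcases eq_or_ne k i with rfl | hki
    · simp [hij.symm]
    rcases eq_or_ne k j with rfl | hkj
    · simp [hij]
    · simp [hki.symm, hkj.symm, Equiv.swap_apply_of_ne_of_ne hki hkj]
  have himg : shear φ v '' convexHull ℝ (range b) = convexHull ℝ (range b) := by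
    rw [AffineMap.image_convexHull, ← range_comp]
    congr 1
    have : shear φ v ∘ b = b ∘ Equiv.swap i j := funext hb
    rw [this, EquivLike.range_comp]
  have hlin : φ.linear v = -2 := by
    have hl := φ.linearMap_vsub (b j) (b i)
    simp only [vsub_eq_sub] at hl
    rw [hl]
    simp only [φ, AffineMap.coe_sub, Pi.sub_apply, AffineBasis.coord_apply]
    simp [hij, hij.symm]; norm_num
  have hcoord : ∀ x, b.coord j (shear φ v x) = b.coord i x := by
    intro x
    have h1 : b.coord j (shear φ v x) = b.coord j x + φ x * (b.coord j).linear v := by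
      have := (b.coord j).map_vadd x (φ x • v)
      simp only [vadd_eq_add, map_smul, smul_eq_mul] at this
      rw [shear_apply, add_comm x, this, add_comm]
    have h2 : (b.coord j).linear v = 1 := by
      have hl := (b.coord j).linearMap_vsub (b j) (b i)
      simp only [vsub_eq_sub] at hl
      rw [hl]
      simp [hij.symm]
    rw [h1, h2]
    simp [φ]
  have key := setIntegral_image_shear μ φ v (isClosed_convexHull_range b).measurableSet
    (by rw [hlin]; norm_num) (b.coord j)
  rw [himg] at key
  rw [key]
  simp [hcoord]

/-- The mean value of an affine function on a simplex is the average of its values at the vertices. -/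
theorem setIntegral_affineMap (g : E →ᵃ[ℝ] ℝ) :
    ∫ x in convexHull ℝ (range b), g x ∂μ =
      μ.real (convexHull ℝ (range b)) * ((∑ i, g (b i)) / Fintype.card ι) := by
  have hint : ∀ i, IntegrableOn (b.coord i) (convexHull ℝ (range b)) μ := fun i =>
    integrableOn_simplex b μ (b.coord i).continuous_of_finiteDimensional
  have : Nonempty ι := b.nonempty
  have hsum : ∑ i, ∫ x in convexHull ℝ (range b), b.coord i x ∂μ =
      μ.real (convexHull ℝ (range b)) := by
    rw [← integral_finsetSum _ fun i _ => hint i]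
    simp
  have hcard : (Fintype.card ι : ℝ) ≠ 0 := Nat.cast_ne_zero.2 Fintype.card_ne_zero
  have hone : ∀ i, ∫ x in convexHull ℝ (range b), b.coord i x ∂μ =
      μ.real (convexHull ℝ (range b)) / Fintype.card ι := by
    intro i
    rw [eq_div_iff hcard, ← hsum,
      Finset.sum_congr rfl fun j _ => setIntegral_coord_eq b μ j i]
    simp [mul_comm]
  have hg : ∫ x in convexHull ℝ (range b), g x ∂μ =
      ∫ x in convexHull ℝ (range b), ∑ i, b.coord i x * g (b i) ∂μ :=
    integral_congr_ae (.of_forall (affineMap_eq_sum_coord b g))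
  rw [hg, integral_finsetSum _ fun i _ => (hint i).mul_const _]
  simp_rw [integral_mul_const, hone]
  rw [← Finset.mul_sum, div_mul_eq_mul_div, mul_div_assoc]

/-- An affine function that vanishes in mean square on a simplex vanishes on its interior, and hence
everywhere. -/
theorem eq_zero_of_setIntegral_sq (g : E →ᵃ[ℝ] ℝ)
    (h : ∫ x in convexHull ℝ (range b), g x * g x ∂μ = 0) (x : E) : g x = 0 := by
  have hg : Continuous g := g.continuous_of_finiteDimensional
  have h1 := (integral_eq_zero_iff_of_nonneg (fun x => mul_self_nonneg (g x))
    (integrableOn_simplex b μ (hg.mul hg))).1 h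
  have hint : ∀ x ∈ interior (convexHull ℝ (range b)), g x * g x = 0 := by
    have h2 : (fun x => g x * g x) =ᵐ[μ.restrict (interior (convexHull ℝ (range b)))] 0 :=
      ae_mono (Measure.restrict_mono_set μ interior_subset) h1
    exact Measure.eqOn_open_of_ae_eq h2 isOpen_interior (hg.mul hg).continuousOn
      continuousOn_const
  obtain ⟨p, hp⟩ := interior_simplex_nonempty b
  have hnear : ∀ᶠ t : ℝ in nhds 0, p + t • (x - p) ∈ interior (convexHull ℝ (range b)) := by
    have hc : Continuous fun t : ℝ => p + t • (x - p) := by fun_prop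
    exact hc.continuousAt.eventually (isOpen_interior.mem_nhds (by simpa using hp))
  obtain ⟨t, ht, ht0⟩ :=
    ((hnear.filter_mono nhdsWithin_le_nhds).and (self_mem_nhdsWithin (s := Ioi (0 : ℝ)))).exists
  have e1 : g p = 0 := mul_self_eq_zero.1 (hint _ hp)
  have e2 : g (p + t • (x - p)) = 0 := mul_self_eq_zero.1 (hint _ ht)
  have e3 : g.linear (x - p) = g x - g p := g.linearMap_vsub x p
  have e4 : g (p + t • (x - p)) = t * g.linear (x - p) + g p := by
    have := g.map_vadd p (t • (x - p))
    simpa [add_comm p] using this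
  rw [e2, e3, e1] at e4
  have : t ≠ 0 := (mem_Ioi.1 ht0).ne'
  have h5 : t * g x = 0 := by linarith
  exact (mul_eq_zero.1 h5).resolve_left this

end Simplex

/-! ### The surface measure of a simplex -/

section Chart

variable {d n : ℕ} {F : Finset (Space d)}

/-- An `n`-simplex in `ℝ^d` is the isometric image of an `n`-simplex in an `n`-dimensional
Euclidean space, and `μHE[n]` on it is the image of the Lebesgue measure there. -/
theorem exists_chart (hF : AffineIndependent ℝ ((↑) : F → Space d)) (hc : F.card = n + 1) :
    ∃ (D : Submodule ℝ (Space d)) (b : AffineBasis F ℝ D) (φ : D →ᵃⁱ[ℝ] Space d),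
      (∀ i, φ (b i) = i) ∧ hull F = φ '' convexHull ℝ (range b) ∧
      (∀ s : Set D, (μHE[n] : Measure (Space d)) (φ '' s) = volume s) ∧
      (μHE[n] : Measure (Space d)).restrict (hull F) =
        ((volume : Measure D).restrict (convexHull ℝ (range b))).map φ := by
  obtain ⟨p, hp⟩ : F.Nonempty := Finset.card_pos.1 (by omega)
  let D : Submodule ℝ (Space d) := vectorSpan ℝ (range ((↑) : F → Space d))
  let φ : D →ᵃⁱ[ℝ] Space d :=
    (AffineIsometryEquiv.constVAdd ℝ (Space d) p).toAffineIsometry.comp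
      D.subtypeₗᵢ.toAffineIsometry
  have hφ : ∀ x : D, φ x = p + x := fun x => rfl
  let q : F → D := fun i => ⟨i - p, vsub_mem_vectorSpan ℝ (mem_range_self i) (mem_range_self (⟨p, hp⟩ : F))⟩
  have hq : ∀ i, φ (q i) = i := fun i => by simp [hφ, q]
  have hqi : AffineIndependent ℝ q := by
    refine AffineIndependent.of_comp φ.toAffineMap ?_
    have : φ.toAffineMap ∘ q = ((↑) : F → Space d) := funext hq
    rwa [this]
  have hfr : Module.finrank ℝ D = n :=
    hF.finrank_vectorSpan (by simpa using hc)
  have htop : affineSpan ℝ (range q) = ⊤ := by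
    rw [hqi.affineSpan_eq_top_iff_card_eq_finrank_add_one, hfr]
    simpa using hc
  let b : AffineBasis F ℝ D := ⟨q, hqi, htop⟩
  have hhull : hull F = φ '' convexHull ℝ (range b) := by
    change _ = φ.toAffineMap '' _
    rw [AffineMap.image_convexHull, ← range_comp]
    have : φ.toAffineMap ∘ b = ((↑) : F → Space d) := funext hq
    rw [this]
    simp
  have hvol : (μHE[n] : Measure D) = volume := by
    rw [← hfr]
    exact InnerProductSpace.euclideanHausdorffMeasure_eq_volume
  refine ⟨D, b, φ, hq, hhull, fun s => ?_, ?_⟩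
  · rw [φ.isometry.euclideanHausdorffMeasure_image, hvol]
  · have hemb : MeasurableEmbedding φ := φ.isometry.isClosedEmbedding.measurableEmbedding
    have h1 : (μHE[n] : Measure (Space d)).restrict (hull F) =
        ((μHE[n] : Measure (Space d)).restrict (range φ)).restrict (hull F) := by
      rw [Measure.restrict_restrict_of_subset]
      rw [hhull]
      exact image_subset_range _ _
    rw [h1, ← φ.isometry.map_euclideanHausdorffMeasure, hvol, hemb.restrict_map, hhull,
      preimage_image_eq _ φ.injective]

variable (hF : AffineIndependent ℝ ((↑) : F → Space d)) (hc : F.card = n + 1)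
include hF hc

theorem surfaceMeasure_lt_top : (μHE[n] : Measure (Space d)) (hull F) < ⊤ := by
  obtain ⟨D, b, φ, -, hh, hm, -⟩ := exists_chart hF hc
  rw [hh, hm]
  exact measure_simplex_lt_top b _

theorem surfaceMeasure_pos : 0 < (μHE[n] : Measure (Space d)) (hull F) := by
  obtain ⟨D, b, φ, -, hh, hm, -⟩ := exists_chart hF hc
  rw [hh, hm]
  exact measure_simplex_pos b _

/-- The relative boundary of a simplex is a null set for the surface measure. -/
theorem surfaceMeasure_sdiff_intrinsicInterior :
    (μHE[n] : Measure (Space d)) (hull F \ intrinsicInterior ℝ (hull F)) = 0 := by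
  obtain ⟨D, b, φ, -, hh, hm, -⟩ := exists_chart hF hc
  rw [hh, AffineIsometry.intrinsicInterior_image, ← image_sdiff φ.injective, hm]
  refine measure_mono_null ?_ ((convex_convexHull ℝ (range b)).addHaar_frontier volume)
  rw [(isClosed_convexHull_range b).frontier_eq]
  exact sdiff_subset_sdiff_right interior_subset_intrinsicInterior

theorem setIntegral_surface_affineMap (g : Space d →ᵃ[ℝ] ℝ) :
    ∫ x in hull F, g x ∂(μHE[n] : Measure (Space d)) =
      (μHE[n] : Measure (Space d)).real (hull F) * ((∑ v ∈ F, g v) / F.card) := by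
  obtain ⟨D, b, φ, hb, hh, hm, hr⟩ := exists_chart hF hc
  have hemb : MeasurableEmbedding φ := φ.isometry.isClosedEmbedding.measurableEmbedding
  rw [hr, hemb.integral_map, measureReal_def, hh, hm]
  have := setIntegral_affineMap b volume (g.comp φ.toAffineMap)
  refine this.trans ?_
  rw [measureReal_def, Fintype.card_coe, ← Finset.sum_coe_sort F]
  congr 3
  exact funext fun i => congrArg g (hb i)

theorem eq_zero_of_setIntegral_surface_sq (g : Space d →ᵃ[ℝ] ℝ)
    (h : ∫ x in hull F, g x * g x ∂(μHE[n] : Measure (Space d)) = 0) {v : Space d} (hv : v ∈ hull F) :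
    g v = 0 := by
  obtain ⟨D, b, φ, -, hh, -, hr⟩ := exists_chart hF hc
  have hemb : MeasurableEmbedding φ := φ.isometry.isClosedEmbedding.measurableEmbedding
  rw [hr, hemb.integral_map] at h
  obtain ⟨y, -, rfl⟩ := hh ▸ hv
  exact eq_zero_of_setIntegral_sq b volume (g.comp φ.toAffineMap) h y

theorem integrableOn_surface {g : Space d → ℝ} (hg : Continuous g) :
    IntegrableOn g (hull F) (μHE[n] : Measure (Space d)) := by
  have hK : IsCompact (hull F) := F.finite_toSet.isCompact_convexHull ℝ
  exact hg.continuousOn.integrableOn_of_subset_isCompact hK hK.measurableSet subset_rfl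
    (surfaceMeasure_lt_top hF hc).ne

/-- A square integrable function on a set that contains the relative interior of a simplex can be
integrated over the simplex against every continuous function. -/
theorem integrableOn_surface_mul {Γ : Set (Space d)} (hΓ : intrinsicInterior ℝ (hull F) ⊆ Γ)
    {ψ : Space d → ℝ} (hψ : MemLp ψ 2 ((μHE[n] : Measure (Space d)).restrict Γ))
    {g : Space d → ℝ} (hg : Continuous g) :
    IntegrableOn (fun x => ψ x * g x) (hull F) (μHE[n] : Measure (Space d)) := by
  have hae : (intrinsicInterior ℝ (hull F) : Set (Space d))
      =ᵐ[(μHE[n] : Measure (Space d))] hull F :=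
    (intrinsicInterior_subset.eventuallyLE).antisymm
      (ae_le_set.2 (surfaceMeasure_sdiff_intrinsicInterior hF hc))
  have h1 : MemLp ψ 2 ((μHE[n] : Measure (Space d)).restrict (hull F)) := by
    rw [← Measure.restrict_congr_set hae]
    exact hψ.mono_measure (Measure.restrict_mono_set _ hΓ)
  have h2 : MemLp g 2 ((μHE[n] : Measure (Space d)).restrict (hull F)) := by
    rw [memLp_two_iff_integrable_sq hg.aestronglyMeasurable]
    exact integrableOn_surface hF hc (hg.pow 2)
  exact h1.integrable_mul h2

end Chart

/-! ### Affine functions on simplices -/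

theorem affineMap_centroid {d : ℕ} (g : Space d →ᵃ[ℝ] ℝ) {F : Finset (Space d)}
    (hF : F.Nonempty) : g (F.centroid ℝ id) = (∑ v ∈ F, g v) / F.card := by
  have hw := F.sum_centroidWeights_eq_one_of_nonempty ℝ hF
  rw [Finset.centroid_def, Finset.map_affineCombination _ _ _ hw,
    Finset.affineCombination_eq_linear_combination _ _ _ hw, Finset.sum_div]
  exact Finset.sum_congr rfl fun v _ => by simp [Finset.centroidWeights_apply]; ring

/-- The linear map sending an affine function to its constant gradient. -/
def gradLin (d : ℕ) : (Space d →ᵃ[ℝ] ℝ) →ₗ[ℝ] Space d :=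
  (InnerProductSpace.toDual ℝ (Space d)).symm.toLinearEquiv.toLinearMap ∘ₗ
    (LinearMap.toContinuousLinearMap (𝕜 := ℝ) (E := Space d) (F' := ℝ)).toLinearMap ∘ₗ
      LinearMap.snd ℝ ℝ (Space d →ₗ[ℝ] ℝ) ∘ₗ
        (AffineMap.toConstProdLinearMap ℝ).toLinearMap

/-- `gradLin d g` is the Riesz representative of the linear part of `g`. -/
theorem inner_gradLin {d : ℕ} (g : Space d →ᵃ[ℝ] ℝ) (v : Space d) :
    inner ℝ (gradLin d g) v = g.linear v := by
  simp [gradLin]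

theorem gradient_affineMap {d : ℕ} (g : Space d →ᵃ[ℝ] ℝ) (x : Space d) :
    gradient g x = gradLin d g := by
  have hder : HasFDerivAt g g.linear.toContinuousLinearMap x := by
    have := (g.linear.toContinuousLinearMap.hasFDerivAt (x := x)).add_const (g 0)
    refine this.congr_of_eventuallyEq (Filter.Eventually.of_forall fun y => ?_)
    exact congrFun g.decomp y
  refine HasGradientAt.gradient ?_
  rw [hasGradientAt_iff_hasFDerivAt]
  have e : InnerProductSpace.toDual ℝ (Space d) (gradLin d g) =
      g.linear.toContinuousLinearMap := by
    ext1 v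
    simp [inner_gradLin]
  rw [e]
  exact hder

theorem gradLin_eq_zero_iff {d : ℕ} (g : Space d →ᵃ[ℝ] ℝ) :
    gradLin d g = 0 ↔ ∀ x y, g x = g y := by
  constructor
  · intro h x y
    have h1 : g.linear (x - y) = g x - g y := g.linearMap_vsub x y
    rw [← inner_gradLin, h, inner_zero_left] at h1
    linarith
  · intro h
    refine ext_inner_right ℝ fun v => ?_
    rw [inner_gradLin, inner_zero_left]
    have h1 : g.linear (v - 0) = g v - g 0 := g.linearMap_vsub v 0
    rw [sub_zero, h v 0, sub_self] at h1
    exact h1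

instance finiteDimensional_affineMap (d : ℕ) : FiniteDimensional ℝ (Space d →ᵃ[ℝ] ℝ) :=
  Module.Finite.equiv (AffineMap.toConstProdLinearMap (k := ℝ) (V1 := Space d) (V2 := ℝ) ℝ).symm

namespace Mesh

/-! ### Barycentric coordinates of the elements -/

variable {d : ℕ} {Ω : Set (Space d)} (T : Mesh Ω)

theorem mem_elements {s : Finset (Space d)} :
    s ∈ T.elements ↔ s ∈ T.faces ∧ s.card = d + 1 := by
  classical
  simp [elements]

theorem mem_elementFaces {s : Finset (Space d)} :
    s ∈ T.elementFaces ↔ s ∈ T.faces ∧ s.card = d := by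
  classical
  simp [elementFaces]

/-- The vertices of an element as an affine basis of `ℝ^d`. -/
def basis (κ : T.elements) : AffineBasis κ.1 ℝ (Space d) where
  toFun := (↑)
  ind' := T.indep (T.mem_elements.1 κ.2).1
  tot' := by
    rw [(T.indep (T.mem_elements.1 κ.2).1).affineSpan_eq_top_iff_card_eq_finrank_add_one]
    simpa using (T.mem_elements.1 κ.2).2

@[simp]
theorem basis_apply (κ : T.elements) (i : κ.1) : T.basis κ i = i := rfl

theorem range_basis (κ : T.elements) : range (T.basis κ) = (κ.1 : Set (Space d)) :=
  Subtype.range_coe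

theorem hull_eq (κ : T.elements) : hull κ.1 = convexHull ℝ (range (T.basis κ)) := by
  rw [range_basis]

theorem mem_hull_iff {κ : T.elements} {x : Space d} :
    x ∈ hull κ.1 ↔ ∀ i, 0 ≤ (T.basis κ).coord i x := by
  rw [hull_eq, AffineBasis.convexHull_eq_nonneg_coord]; rfl

theorem mem_interior_hull_iff {κ : T.elements} {x : Space d} :
    x ∈ interior (hull κ.1) ↔ ∀ i, 0 < (T.basis κ).coord i x := by
  rw [hull_eq, AffineBasis.interior_convexHull]; rfl

variable {T} in
/-- An affine function is determined by its values at the vertices of an element. -/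
theorem affineMap_ext {κ : T.elements} {g h : Space d →ᵃ[ℝ] ℝ} (H : ∀ v ∈ κ.1, g v = h v) :
    g = h := by
  ext x
  rw [affineMap_eq_sum_coord (T.basis κ) g, affineMap_eq_sum_coord (T.basis κ) h]
  exact Finset.sum_congr rfl fun i _ => by rw [basis_apply, H i i.2]

/-- The affine function with prescribed values at the vertices of an element. -/
def interp (κ : T.elements) (c : Space d → ℝ) : Space d →ᵃ[ℝ] ℝ :=
  (∑ i : κ.1, c i • LinearMap.proj i : (κ.1 → ℝ) →ₗ[ℝ] ℝ).toAffineMap.comp (T.basis κ).coords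

theorem interp_apply (κ : T.elements) (c : Space d → ℝ) {v : Space d} (hv : v ∈ κ.1) :
    T.interp κ c v = c v := by
  have h : ∀ i : κ.1, (T.basis κ).coord i v = if i = ⟨v, hv⟩ then 1 else 0 := fun i =>
    (T.basis κ).coord_apply i ⟨v, hv⟩
  simp [interp, AffineBasis.coords_apply, h]

open Classical in
/-- The affine function on the element `κ` that vanishes on the face `F` and takes the value one at
the opposite vertex. -/
def faceCoord (κ : T.elements) (F : Finset (Space d)) : Space d →ᵃ[ℝ] ℝ :=
  T.interp κ fun v => if v ∈ F then 0 else 1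

variable {T} {κ κ' : T.elements} {F : Finset (Space d)}

theorem faceCoord_apply_of_mem (hF : F ⊆ κ.1) {v : Space d} (hv : v ∈ F) :
    T.faceCoord κ F v = 0 := by
  rw [faceCoord, interp_apply _ _ _ (hF hv), if_pos hv]

theorem faceCoord_apply_of_notMem {v : Space d} (hv : v ∈ κ.1) (hvF : v ∉ F) :
    T.faceCoord κ F v = 1 := by
  rw [faceCoord, interp_apply _ _ _ hv, if_neg hvF]

open Classical in
theorem exists_apex (hF : F ∈ T.elementFaces) (hFκ : F ⊆ κ.1) :
    ∃ a, a ∉ F ∧ κ.1 = insert a F := by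
  have h1 := (T.mem_elementFaces.1 hF).2
  have h2 := (T.mem_elements.1 κ.2).2
  have h3 : (κ.1 \ F).card = 1 := by
    rw [Finset.card_sdiff_of_subset hFκ]; omega
  obtain ⟨a, ha⟩ := Finset.card_eq_one.1 h3
  have ha' : a ∈ κ.1 \ F := by simp [ha]
  refine ⟨a, (Finset.mem_sdiff.1 ha').2, ?_⟩
  rw [← Finset.sdiff_union_of_subset hFκ, ha]
  rfl

theorem elementFace_nonempty (hF : F ∈ T.elementFaces) : F.Nonempty :=
  T.nonempty_of_mem_faces (T.mem_elementFaces.1 hF).1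

/-- An affine function that vanishes on a face is a multiple of the coordinate of the opposite
vertex. -/
theorem eq_smul_faceCoord (hF : F ∈ T.elementFaces) (hFκ : F ⊆ κ.1) {g : Space d →ᵃ[ℝ] ℝ}
    (hg : ∀ v ∈ F, g v = 0) {a : Space d} (ha : a ∈ κ.1) (haF : a ∉ F) :
    g = g a • T.faceCoord κ F := by
  classical
  obtain ⟨a', ha', hκ⟩ := exists_apex hF hFκ
  have haa : a = a' := by
    rw [hκ, Finset.mem_insert] at ha
    exact ha.resolve_right haF
  subst haa
  refine affineMap_ext (κ := κ) fun v hv => ?_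
  rw [AffineMap.coe_smul, Pi.smul_apply]
  rcases Finset.mem_insert.1 (hκ ▸ hv) with rfl | hvF
  · rw [faceCoord_apply_of_notMem hv haF]; simp
  · rw [hg v hvF, faceCoord_apply_of_mem hFκ hvF]; simp

/-- Starting at the centre of a face and moving towards the side of the element, one enters the
interior of the element. -/
theorem eventually_mem_interior_hull (hF : F ∈ T.elementFaces) (hFκ : F ⊆ κ.1) {y : Space d}
    (hy : 0 < T.faceCoord κ F y) :
    ∀ᶠ t : ℝ in nhdsWithin 0 (Ioi 0),
      AffineMap.lineMap (F.centroid ℝ id) y t ∈ interior (hull κ.1) := by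
  classical
  have hne := elementFace_nonempty hF
  simp_rw [mem_interior_hull_iff, Filter.eventually_all]
  intro i
  have hcomp : ∀ t : ℝ, (T.basis κ).coord i (AffineMap.lineMap (F.centroid ℝ id) y t) =
      (1 - t) * (T.basis κ).coord i (F.centroid ℝ id) + t * (T.basis κ).coord i y := by
    intro t
    rw [AffineMap.apply_lineMap, AffineMap.lineMap_apply_ring]
  simp_rw [hcomp]
  by_cases hi : i.1 ∈ F
  · have hpos : 0 < (T.basis κ).coord i (F.centroid ℝ id) := by
      rw [affineMap_centroid _ hne]
      refine div_pos (Finset.sum_pos' (fun v hv => ?_) ⟨i, hi, ?_⟩)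
        (Nat.cast_pos.2 hne.card_pos)
      · have := (T.basis κ).coord_apply i ⟨v, hFκ hv⟩
        rw [basis_apply] at this
        rw [this]; split_ifs <;> norm_num
      · have := (T.basis κ).coord_apply i i
        rw [basis_apply] at this
        rw [this]; simp
    have hc : Continuous fun t : ℝ => (1 - t) * (T.basis κ).coord i (F.centroid ℝ id) +
        t * (T.basis κ).coord i y := by fun_prop
    exact (hc.continuousAt.eventually (lt_mem_nhds (by simpa using hpos))).filter_mono
      nhdsWithin_le_nhds
  · have hvan : ∀ v ∈ F, (T.basis κ).coord i v = 0 := fun v hv => by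
      have := (T.basis κ).coord_apply_ne (i := i) (j := ⟨v, hFκ hv⟩)
        (fun h => hi (by rw [h]; exact hv))
      rwa [basis_apply] at this
    have hone : (T.basis κ).coord i i.1 = 1 := (T.basis κ).coord_apply_eq i
    have heq := eq_smul_faceCoord hF hFκ hvan i.2 hi
    rw [hone, one_smul] at heq
    have h0 : (T.basis κ).coord i (F.centroid ℝ id) = 0 := by
      rw [affineMap_centroid _ hne, Finset.sum_eq_zero hvan, zero_div]
    filter_upwards [self_mem_nhdsWithin] with t ht
    rw [h0, heq]
    simpa using mul_pos ht hy

theorem vertex_notMem_of_ne (hF : F ∈ T.elementFaces) (hne : κ ≠ κ') (hFκ : F ⊆ κ.1)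
    (hFκ' : F ⊆ κ'.1) {b : Space d} (hb : b ∈ κ'.1) (hbF : b ∉ F) : b ∉ κ.1 := by
  classical
  intro hbκ
  obtain ⟨a, ha, h1⟩ := exists_apex hF hFκ
  obtain ⟨a', ha', h2⟩ := exists_apex hF hFκ'
  have e1 : b = a := (Finset.mem_insert.1 (h1 ▸ hbκ)).resolve_right hbF
  have e2 : b = a' := (Finset.mem_insert.1 (h2 ▸ hb)).resolve_right hbF
  exact hne (Subtype.ext (by rw [h1, h2, ← e1, ← e2]))

/-- The segment from the centre of a face to a vertex of the element stays in the element. -/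
theorem lineMap_centroid_mem_hull (hF : F ∈ T.elementFaces) (hFκ : F ⊆ κ.1) {b : Space d}
    (hb : b ∈ κ.1) {t : ℝ} (ht0 : 0 ≤ t) (ht1 : t ≤ 1) :
    AffineMap.lineMap (F.centroid ℝ id) b t ∈ hull κ.1 := by
  have h1 : F.centroid ℝ id ∈ hull κ.1 := by
    have := F.centroid_mem_convexHull (R := ℝ) (elementFace_nonempty hF)
    exact convexHull_mono (Finset.coe_subset.2 hFκ) this
  exact (convex_convexHull ℝ _).lineMap_mem h1 (subset_convexHull ℝ _ hb) ⟨ht0, ht1⟩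

/-- Two different elements lie on opposite sides of a common face. -/
theorem faceCoord_neg (hF : F ∈ T.elementFaces) (hne : κ ≠ κ') (hFκ : F ⊆ κ.1)
    (hFκ' : F ⊆ κ'.1) {b : Space d} (hb : b ∈ κ'.1) (hbF : b ∉ F) :
    T.faceCoord κ F b < 0 := by
  classical
  obtain ⟨a, ha, hκ⟩ := exists_apex hF hFκ
  have haκ : a ∈ κ.1 := by rw [hκ]; exact Finset.mem_insert_self _ _
  have hbκ := vertex_notMem_of_ne hF hne hFκ hFκ' hb hbF
  rcases lt_trichotomy (T.faceCoord κ F b) 0 with h | h | h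
  · exact h
  · have h0 := eq_smul_faceCoord hF hFκ' (fun v hv => faceCoord_apply_of_mem hFκ hv) hb hbF
    have h1 := faceCoord_apply_of_notMem haκ ha
    rw [h0, h] at h1
    simp at h1
  · exfalso
    obtain ⟨t, ⟨ht, ht1⟩, ht0⟩ := (((eventually_mem_interior_hull hF hFκ h).and
      ((gt_mem_nhds one_pos).filter_mono nhdsWithin_le_nhds)).and
        (self_mem_nhdsWithin (s := Ioi (0 : ℝ)))).exists
    have hmem' := lineMap_centroid_mem_hull hF hFκ' hb (mem_Ioi.1 ht0).le ht1.le
    have hint := T.inter_subset_convexHull (T.mem_elements.1 κ.2).1 (T.mem_elements.1 κ'.2).1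
      ⟨interior_subset ht, hmem'⟩
    have hsub : (κ.1 ∩ κ'.1 : Set (Space d)) ⊆ {x | T.faceCoord κ F x ≤ 0} := by
      rintro v ⟨hv, hv'⟩
      have hvF : v ∈ F := by
        by_contra hvF
        exact vertex_notMem_of_ne hF hne hFκ hFκ' hv' hvF hv
      exact (faceCoord_apply_of_mem hFκ hvF).le
    have hconv : Convex ℝ {x | T.faceCoord κ F x ≤ 0} :=
      (convex_Iic (0 : ℝ)).affine_preimage (T.faceCoord κ F)
    have hle := convexHull_min hsub hconv hint
    have h0 : T.faceCoord κ F (F.centroid ℝ id) = 0 := by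
      rw [affineMap_centroid _ (elementFace_nonempty hF),
        Finset.sum_eq_zero fun v hv => faceCoord_apply_of_mem hFκ hv, zero_div]
    rw [mem_ofPred_eq, AffineMap.apply_lineMap, AffineMap.lineMap_apply_ring, h0] at hle
    have := mul_pos (mem_Ioi.1 ht0) h
    linarith

/-- The coordinates of two elements with respect to a common face are proportional. -/
theorem faceCoord_eq_smul (hF : F ∈ T.elementFaces) (hFκ : F ⊆ κ.1)
    (hFκ' : F ⊆ κ'.1) {b : Space d} (hb : b ∈ κ'.1) (hbF : b ∉ F) :
    T.faceCoord κ F = T.faceCoord κ F b • T.faceCoord κ' F :=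
  eq_smul_faceCoord hF hFκ' (fun _ hv => faceCoord_apply_of_mem hFκ hv) hb hbF

/-- A face belongs to at most two elements. -/
theorem eq_or_eq_of_subset {κ'' : T.elements} (hF : F ∈ T.elementFaces) (hne : κ ≠ κ')
    (hFκ : F ⊆ κ.1) (hFκ' : F ⊆ κ'.1) (hFκ'' : F ⊆ κ''.1) : κ'' = κ ∨ κ'' = κ' := by
  classical
  by_contra! h
  obtain ⟨b, hb, hκ'⟩ := exists_apex hF hFκ'
  obtain ⟨c, hc, hκ''⟩ := exists_apex hF hFκ''
  have hbκ : b ∈ κ'.1 := by rw [hκ']; exact Finset.mem_insert_self _ _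
  have hcκ : c ∈ κ''.1 := by rw [hκ'']; exact Finset.mem_insert_self _ _
  have h1 := faceCoord_neg hF hne hFκ hFκ' hbκ hb
  have h2 := faceCoord_neg hF h.1.symm hFκ hFκ'' hcκ hc
  have h3 := faceCoord_neg hF h.2.symm hFκ' hFκ'' hcκ hc
  rw [faceCoord_eq_smul hF hFκ hFκ' hbκ hb, AffineMap.coe_smul, Pi.smul_apply, smul_eq_mul] at h2
  have := mul_pos_of_neg_of_neg h1 h3
  linarith

/-! ### Boundary faces -/

theorem isClosed_hull (s : Finset (Space d)) : IsClosed (hull s) :=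
  s.finite_toSet.isClosed_convexHull ℝ

theorem hull_subset_closure {s : Finset (Space d)} (hs : s ∈ T.faces) : hull s ⊆ closure Ω := by
  rw [← T.space_eq]
  exact T.convexHull_subset_space hs

theorem element_subset_closure (κ : T.elements) : hull κ.1 ⊆ closure Ω :=
  hull_subset_closure (T.mem_elements.1 κ.2).1

theorem exists_element_superset {s : Finset (Space d)} (hs : s ∈ T.faces) :
    ∃ κ : T.elements, s ⊆ κ.1 := by
  obtain ⟨t, ht, hst, hc⟩ := T.pure_dim s hs
  exact ⟨⟨t, T.mem_elements.2 ⟨ht, hc⟩⟩, hst⟩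

variable (T) in
theorem exists_element_mem_hull {x : Space d} (hx : x ∈ closure Ω) :
    ∃ κ : T.elements, x ∈ hull κ.1 := by
  rw [← T.space_eq, Geometry.SimplicialComplex.mem_space_iff] at hx
  obtain ⟨s, hs, hxs⟩ := hx
  obtain ⟨κ, hκ⟩ := exists_element_superset hs
  exact ⟨κ, convexHull_mono (Finset.coe_subset.2 hκ) hxs⟩

theorem interior_closure_eq (hΩo : IsOpen Ω) (hΩc : Convex ℝ Ω) : interior (closure Ω) = Ω := by
  rcases Ω.eq_empty_or_nonempty with rfl | h
  · simp
  · rw [hΩc.interior_closure_eq_interior_of_nonempty_interior (by rwa [hΩo.interior_eq]),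
      hΩo.interior_eq]

theorem interior_hull_subset (hΩo : IsOpen Ω) (hΩc : Convex ℝ Ω) (κ : T.elements) :
    interior (hull κ.1) ⊆ Ω :=
  (interior_mono (element_subset_closure κ)).trans (interior_closure_eq hΩo hΩc).subset

/-- A face shared by two elements passes through the domain: its centre lies between an interior
point of one element and a vertex of the other. -/
theorem not_hull_subset_frontier (hΩo : IsOpen Ω) (hΩc : Convex ℝ Ω) (hF : F ∈ T.elementFaces)
    (hne : κ ≠ κ') (hFκ : F ⊆ κ.1) (hFκ' : F ⊆ κ'.1) : ¬ hull F ⊆ frontier Ω := by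
  classical
  intro hfr
  obtain ⟨b, hb, hκ'⟩ := exists_apex hF hFκ'
  have hbκ : b ∈ κ'.1 := by rw [hκ']; exact Finset.mem_insert_self _ _
  have hneg := faceCoord_neg hF hne hFκ hFκ' hbκ hb
  set c := F.centroid ℝ id with hc
  have hcF : c ∈ hull F := F.centroid_mem_convexHull (R := ℝ) (elementFace_nonempty hF)
  have h0 : T.faceCoord κ F c = 0 := by
    rw [affineMap_centroid _ (elementFace_nonempty hF),
      Finset.sum_eq_zero fun v hv => faceCoord_apply_of_mem hFκ hv, zero_div]
  have hpos : 0 < T.faceCoord κ F (AffineMap.lineMap c b (-1 : ℝ)) := by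
    rw [AffineMap.apply_lineMap, AffineMap.lineMap_apply_ring, h0]
    linarith
  obtain ⟨t, ht, ht0⟩ := ((eventually_mem_interior_hull hF hFκ hpos).and
    (self_mem_nhdsWithin (s := Ioi (0 : ℝ)))).exists
  replace ht0 : 0 < t := ht0
  have hp := interior_hull_subset hΩo hΩc κ ht
  have hseg := hΩc.openSegment_interior_closure_subset_interior
    (by rwa [hΩo.interior_eq]) (element_subset_closure κ' (subset_convexHull ℝ _ hbκ))
  -- `c` divides the segment from `c - t (b - c)` to `b` in the ratio `t : 1`
  have hcΩ : c ∈ Ω := by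
    rw [← hΩo.interior_eq]
    refine hseg ⟨1 / (1 + t), t / (1 + t), by positivity, by positivity, by field_simp, ?_⟩
    rw [← hc]
    simp only [AffineMap.lineMap_apply, vsub_eq_sub, vadd_eq_add]
    have h1 : (1 + t) ≠ 0 := by positivity
    match_scalars <;> field_simp <;> ring
  have := hfr hcF
  rw [hΩo.frontier_eq] at this
  exact this.2 hcΩ

/-- A boundary point in an element is not an interior point of the element, so that one of its
barycentric coordinates vanishes. -/
theorem exists_face_of_mem_frontier (hd : d ≠ 0) (hΩo : IsOpen Ω) (hΩc : Convex ℝ Ω) {x : Space d}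
    (hx : x ∈ frontier Ω) : ∃ F ∈ T.elementFaces, x ∈ hull F := by
  classical
  obtain ⟨κ, hκ⟩ := T.exists_element_mem_hull (frontier_subset_closure hx)
  have hxi : x ∉ interior (hull κ.1) := fun h => by
    rw [hΩo.frontier_eq] at hx
    exact hx.2 (interior_hull_subset hΩo hΩc κ h)
  rw [mem_interior_hull_iff] at hxi
  push Not at hxi
  obtain ⟨i, hi⟩ := hxi
  have hnn := (T.mem_hull_iff).1 hκ
  have hi0 : (T.basis κ).coord i x = 0 := le_antisymm hi (hnn i)
  obtain ⟨hκf, hκc⟩ := T.mem_elements.1 κ.2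
  have hcard : (κ.1.erase i).card = d := by
    rw [Finset.card_erase_of_mem i.2, hκc]; rfl
  refine ⟨κ.1.erase i, T.mem_elementFaces.2 ⟨T.down_closed hκf (Finset.erase_subset _ _)
    (Finset.card_pos.1 (by omega)), hcard⟩, ?_⟩
  have hsum : ∑ j ∈ Finset.univ.erase i, (T.basis κ).coord j x = 1 := by
    rw [Finset.sum_erase (f := fun j => (T.basis κ).coord j x) _ hi0, (T.basis κ).sum_coord_apply_eq_one]
  have hcomb : ∑ j ∈ Finset.univ.erase i, (T.basis κ).coord j x • T.basis κ j = x := by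
    rw [Finset.sum_erase (f := fun j => (T.basis κ).coord j x • T.basis κ j) _
      (by rw [hi0, zero_smul]),
      (T.basis κ).linear_combination_coord_eq_self]
  rw [← hcomb]
  refine (convex_convexHull ℝ _).sum_mem (fun j _ => hnn j) hsum fun j hj => ?_
  refine subset_convexHull ℝ _ ?_
  simp only [Finset.mem_coe, Finset.mem_erase, basis_apply]
  exact ⟨fun h => (Finset.mem_erase.1 hj).1 (Subtype.ext h), j.2⟩

/-- A set in the closure of an open convex set that has a relative interior point on the boundary
lies entirely in the boundary. -/
theorem subset_frontier_of_intrinsicInterior {K : Set (Space d)} (hΩo : IsOpen Ω)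
    (hΩc : Convex ℝ Ω) (hK : K ⊆ closure Ω) {x : Space d} (hx : x ∈ intrinsicInterior ℝ K)
    (hxΩ : x ∈ frontier Ω) : K ⊆ frontier Ω := by
  intro y hy
  rw [hΩo.frontier_eq] at hxΩ ⊢
  refine ⟨hK hy, fun hyΩ => hxΩ.2 ?_⟩
  obtain ⟨x', hx', rfl⟩ := mem_intrinsicInterior.1 hx
  -- the segment from `y` to `x` can be prolonged slightly beyond `x` inside `K`
  have hmem : ∀ t : ℝ, AffineMap.lineMap (x' : Space d) y (-t) ∈ affineSpan ℝ K := fun t =>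
    AffineMap.lineMap_mem _ x'.2 (subset_affineSpan ℝ K hy)
  have hcont : Continuous fun t : ℝ =>
      (⟨AffineMap.lineMap (x' : Space d) y (-t), hmem t⟩ : affineSpan ℝ K) := by
    refine Continuous.subtype_mk ?_ _
    simp only [AffineMap.lineMap_apply]
    fun_prop
  have hev := (hcont.continuousAt (x := 0)).eventually (isOpen_interior.mem_nhds
    (by simpa using hx'))
  obtain ⟨t, ht, ht0⟩ := ((hev.filter_mono nhdsWithin_le_nhds).and
    (self_mem_nhdsWithin (s := Ioi (0 : ℝ)))).exists
  replace ht0 : 0 < t := ht0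
  have hmemK : AffineMap.lineMap (x' : Space d) y (-t) ∈ K :=
    interior_subset (s := ((↑) : affineSpan ℝ K → Space d) ⁻¹' K) ht
  rw [← hΩo.interior_eq]
  refine hΩc.openSegment_interior_closure_subset_interior (by rwa [hΩo.interior_eq])
    (hK hmemK) ⟨t / (1 + t), 1 / (1 + t), by positivity, by positivity, by field_simp; ring, ?_⟩
  simp only [AffineMap.lineMap_apply, vsub_eq_sub, vadd_eq_add]
  have h1 : (1 + t) ≠ 0 := by positivity
  match_scalars <;> field_simp <;> ring

theorem elementFace_indep (hF : F ∈ T.elementFaces) :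
    AffineIndependent ℝ ((↑) : F → Space d) :=
  T.indep (T.mem_elementFaces.1 hF).1

theorem elementFace_card (hF : F ∈ T.elementFaces) : F.card = d - 1 + 1 := by
  have h1 := (T.mem_elementFaces.1 hF).2
  have h2 := (elementFace_nonempty hF).card_pos
  omega

/-- A part of the boundary of positive measure meets the relative interior of a boundary face. -/
theorem exists_boundaryFace (hd : d ≠ 0) (hΩo : IsOpen Ω) (hΩc : Convex ℝ Ω)
    {Γ : Set (Space d)} (hΓ : Γ ⊆ frontier Ω)
    (hpos : 0 < (μHE[d - 1] : Measure (Space d)) Γ) :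
    ∃ F ∈ T.elementFaces, hull F ⊆ frontier Ω ∧
      (intrinsicInterior ℝ (hull F) ∩ Γ).Nonempty := by
  by_contra! h
  refine hpos.ne' (measure_mono_null (t := ⋃ F ∈ T.elementFaces,
    (hull F \ intrinsicInterior ℝ (hull F))) (fun x hx => ?_) ?_)
  · obtain ⟨F, hF, hxF⟩ := exists_face_of_mem_frontier (T := T) hd hΩo hΩc (hΓ hx)
    refine mem_biUnion hF ⟨hxF, fun hxi => ?_⟩
    have hfr := subset_frontier_of_intrinsicInterior hΩo hΩc
      (hull_subset_closure (T.mem_elementFaces.1 hF).1) hxi (hΓ hx)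
    exact notMem_empty x (h F hF hfr ▸ ⟨hxi, hx⟩)
  · exact (measure_biUnion_null_iff T.elementFaces.countable_toSet).2
      fun F hF => surfaceMeasure_sdiff_intrinsicInterior (elementFace_indep hF)
      (elementFace_card hF)

theorem intrinsicInterior_hull_nonempty (hF : F ∈ T.elementFaces) :
    (intrinsicInterior ℝ (hull F)).Nonempty :=
  (convexHull_nonempty_iff.2 (elementFace_nonempty hF)).intrinsicInterior (convex_convexHull ℝ _)

/-! ### Connectedness of the mesh through faces -/

theorem affineSpan_ne_top_of_card_le {s : Finset (Space d)} (hs : s.card ≤ d) :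
    affineSpan ℝ (s : Set (Space d)) ≠ ⊤ := by
  intro h
  rcases s.eq_empty_or_nonempty with rfl | hne
  · simp at h
  · have h1 := finrank_vectorSpan_range_le ℝ ((↑) : s → Space d) (n := s.card - 1)
      (by have := hne.card_pos; simp; omega)
    have hv : vectorSpan ℝ (range ((↑) : s → Space d)) = ⊤ := by
      rw [Subtype.range_coe]
      rw [← direction_affineSpan, h, AffineSubspace.direction_top]
    have h2 := congrArg (fun p : Submodule ℝ (Space d) => Module.finrank ℝ p) hv
    simp only [finrank_top, finrank_euclideanSpace_fin] at h2
    have := hne.card_pos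
    omega

open Classical in
/-- Two elements that do not share a face have fewer than `d` common vertices. -/
theorem card_inter_lt (h : ∀ F ∈ T.elementFaces, F ⊆ κ.1 → ¬ F ⊆ κ'.1) (hd : d ≠ 0) :
    (κ.1 ∩ κ'.1).card < d := by
  by_contra! hle
  obtain ⟨F, hFs, hFc⟩ := Finset.exists_subset_card_eq hle
  refine h F (T.mem_elementFaces.2 ⟨T.down_closed (T.mem_elements.1 κ.2).1
    (hFs.trans Finset.inter_subset_left) (Finset.card_pos.1 (by omega)), hFc⟩)
    (hFs.trans Finset.inter_subset_left) (hFs.trans Finset.inter_subset_right)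

theorem notMem_hull_of_mem_interior (hne : κ ≠ κ') {x : Space d} (hx : x ∈ interior (hull κ.1)) :
    x ∉ hull κ'.1 := by
  intro hx'
  obtain ⟨i, hi, hi'⟩ : ∃ i ∈ κ.1, i ∉ κ'.1 := by
    by_contra! h
    exact hne (Subtype.ext (Finset.eq_of_subset_of_card_le h
      (by rw [(T.mem_elements.1 κ.2).2, (T.mem_elements.1 κ'.2).2])))
  have hint := T.inter_subset_convexHull (T.mem_elements.1 κ.2).1 (T.mem_elements.1 κ'.2).1
    ⟨interior_subset hx, hx'⟩
  have hsub : (κ.1 ∩ κ'.1 : Set (Space d)) ⊆ {y | (T.basis κ).coord ⟨i, hi⟩ y ≤ 0} := by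
    rintro v ⟨hv, hv'⟩
    have := (T.basis κ).coord_apply_ne (i := ⟨i, hi⟩) (j := ⟨v, hv⟩)
      (fun h => hi' (by rw [Subtype.mk.injEq] at h; rw [h]; exact hv'))
    rw [basis_apply] at this
    exact this.le
  have hle := convexHull_min hsub ((convex_Iic (0 : ℝ)).affine_preimage _) hint
  exact not_lt.2 hle ((T.mem_interior_hull_iff).1 hx ⟨i, hi⟩)

/-- Any two elements are connected by a chain of elements with common faces. The segment between
generic interior points of two elements avoids all simplices of dimension at most `d - 2`, so it
can pass from one element to another only through a common face. -/
theorem eq_of_forall_shared_face (hd : d ≠ 0) (hΩc : Convex ℝ Ω) {α : Type*}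
    (f : T.elements → α)
    (hf : ∀ F ∈ T.elementFaces, ∀ κ κ' : T.elements, F ⊆ κ.1 → F ⊆ κ'.1 → f κ = f κ')
    (κ₀ κ₁ : T.elements) : f κ₀ = f κ₁ := by
  classical
  by_contra hne
  obtain ⟨x, hx⟩ : (interior (hull κ₀.1)).Nonempty := by
    rw [hull_eq]; exact interior_simplex_nonempty _
  -- `y` has to avoid the affine spans of `x` and the common vertices of any two elements of
  -- different classes; these spans are proper subspaces, as there are at most `d - 1` such vertices
  let N : Set (Space d) := ⋃ κ : T.elements, ⋃ κ' : T.elements, ⋃ _ : f κ ≠ f κ',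
    (affineSpan ℝ ((insert x (κ.1 ∩ κ'.1) : Finset (Space d)) : Set (Space d)) : Set (Space d))
  have hN : volume N = 0 := by
    refine measure_iUnion_null fun κ => measure_iUnion_null fun κ' =>
      measure_iUnion_null fun h => Measure.addHaar_affineSubspace _ _ ?_
    refine affineSpan_ne_top_of_card_le ((Finset.card_insert_le _ _).trans ?_)
    exact card_inter_lt (fun F hF h1 h2 => h (hf F hF κ κ' h1 h2)) hd
  obtain ⟨y, hy, hyN⟩ : ∃ y ∈ interior (hull κ₁.1), y ∉ N := by
    by_contra! h
    have hpos : 0 < volume (interior (hull κ₁.1)) := by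
      refine isOpen_interior.measure_pos _ ?_
      rw [hull_eq]; exact interior_simplex_nonempty _
    exact hpos.ne' (measure_mono_null h hN)
  let U : Set (Space d) := ⋃ κ : {κ : T.elements // f κ = f κ₀}, hull κ.1.1
  let U' : Set (Space d) := ⋃ κ : {κ : T.elements // f κ ≠ f κ₀}, hull κ.1.1
  have hU : IsClosed U := isClosed_iUnion_of_finite fun κ => isClosed_hull _
  have hU' : IsClosed U' := isClosed_iUnion_of_finite fun κ => isClosed_hull _
  have hcover : segment ℝ x y ⊆ U ∪ U' := by
    intro p hp
    have hpΩ : p ∈ closure Ω := hΩc.closure.segment_subset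
      (element_subset_closure κ₀ (interior_subset hx))
      (element_subset_closure κ₁ (interior_subset hy)) hp
    obtain ⟨κ, hκ⟩ := T.exists_element_mem_hull hpΩ
    by_cases h : f κ = f κ₀
    · exact Or.inl (mem_iUnion.2 ⟨⟨κ, h⟩, hκ⟩)
    · exact Or.inr (mem_iUnion.2 ⟨⟨κ, h⟩, hκ⟩)
  obtain ⟨p, hp, hpU, hpU'⟩ := isPreconnected_closed_iff.1 (convex_segment x y).isPreconnected
    U U' hU hU' hcover
    ⟨x, left_mem_segment ℝ x y, mem_iUnion.2 ⟨⟨κ₀, rfl⟩, interior_subset hx⟩⟩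
    ⟨y, right_mem_segment ℝ x y, mem_iUnion.2 ⟨⟨κ₁, Ne.symm hne⟩, interior_subset hy⟩⟩
  obtain ⟨⟨κ, hκ⟩, hpκ⟩ := mem_iUnion.1 hpU
  obtain ⟨⟨κ', hκ'⟩, hpκ'⟩ := mem_iUnion.1 hpU'
  have hpx : p ≠ x := by
    rintro rfl
    exact notMem_hull_of_mem_interior (κ := κ₀) (κ' := κ') (fun h => hκ' (by rw [← h])) hx hpκ'
  have hpspan : p ∈ affineSpan ℝ
      ((insert x (κ.1 ∩ κ'.1) : Finset (Space d)) : Set (Space d)) := by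
    have h1 := T.inter_subset_convexHull (T.mem_elements.1 κ.2).1 (T.mem_elements.1 κ'.2).1
      ⟨hpκ, hpκ'⟩
    refine convexHull_subset_affineSpan _ (convexHull_mono ?_ h1)
    intro v hv
    simp [hv.1, hv.2]
  rw [segment_eq_image_lineMap] at hp
  obtain ⟨t, -, rfl⟩ := hp
  have ht : t ≠ 0 := by
    rintro rfl
    simp at hpx
  refine hyN (mem_iUnion.2 ⟨κ, mem_iUnion.2 ⟨κ', mem_iUnion.2 ⟨fun h => hκ' (h ▸ hκ), ?_⟩⟩⟩)
  -- `y` lies on the line through `x` and `p`, and so in the exceptional set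
  have hyeq : y = AffineMap.lineMap x (AffineMap.lineMap x y t : Space d) t⁻¹ := by
    simp only [AffineMap.lineMap_apply, vsub_eq_sub, vadd_eq_add]
    match_scalars <;> field_simp
    ring
  rw [hyeq]
  exact AffineMap.lineMap_mem _ (subset_affineSpan ℝ _ (by simp)) hpspan

/-! ### Volumes of neighbouring elements -/

theorem volume_hull_lt_top (κ : T.elements) : volume (hull κ.1) < ⊤ := by
  rw [hull_eq]; exact measure_simplex_lt_top _ _

theorem volume_hull_pos (κ : T.elements) : 0 < volume.real (hull κ.1) := by
  rw [measureReal_def, ENNReal.toReal_pos_iff]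
  refine ⟨?_, volume_hull_lt_top κ⟩
  rw [hull_eq]; exact measure_simplex_pos _ _

/-- The shear that fixes the common face and moves one opposite vertex to the other one shows that
the volumes of neighbouring elements are proportional to the heights over their common face. -/
theorem volume_hull_eq (hF : F ∈ T.elementFaces) (hFκ : F ⊆ κ.1) (hFκ' : F ⊆ κ'.1)
    {b : Space d} (hb : b ∈ κ'.1) (hbF : b ∉ F) :
    volume.real (hull κ'.1) = |T.faceCoord κ F b| * volume.real (hull κ.1) := by
  classical
  obtain ⟨a, ha, hκ⟩ := exists_apex hF hFκ
  obtain ⟨b', hb', hκ'⟩ := exists_apex hF hFκ'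
  have hbb : b = b' := (Finset.mem_insert.1 (hκ' ▸ hb)).resolve_right hbF
  subst hbb
  have haκ : a ∈ κ.1 := by rw [hκ]; exact Finset.mem_insert_self _ _
  have hone : T.faceCoord κ F a = 1 := faceCoord_apply_of_notMem haκ ha
  have hF' : shear (T.faceCoord κ F) (b - a) '' (F : Set (Space d)) = F := by
    have : EqOn (shear (T.faceCoord κ F) (b - a)) id (F : Set (Space d)) := fun v hv => by
      rw [shear_apply, faceCoord_apply_of_mem hFκ hv]; simp
    rw [this.image_eq, image_id]
  have himg : shear (T.faceCoord κ F) (b - a) '' hull κ.1 = hull κ'.1 := by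
    rw [AffineMap.image_convexHull, hκ, hκ', hull, Finset.coe_insert, Finset.coe_insert,
      image_insert_eq, hF', shear_apply, hone]
    simp
  have hlin : (T.faceCoord κ F).linear (b - a) = T.faceCoord κ F b - 1 := by
    rw [← hone]; exact (T.faceCoord κ F).linearMap_vsub b a
  rw [← himg, measureReal_def, addHaar_image_shear, hlin, ENNReal.toReal_mul,
    ENNReal.toReal_ofReal (abs_nonneg _), measureReal_def]
  congr 2
  ring

end Mesh

namespace Mesh

variable {d : ℕ} {Ω : Set (Space d)} (T : Mesh Ω)

/-! ### Jumps and the Crouzeix–Raviart space -/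

/-- The restriction of a piecewise affine function to an element. -/
def restrictLin (κ : T.elements) : T.BrokenP1 →ₗ[ℝ] (Space d →ᵃ[ℝ] ℝ) :=
  LinearMap.proj (φ := fun _ : T.elements => Space d →ᵃ[ℝ] ℝ) κ

open Classical in
/-- The jump over `F` as a linear map from piecewise affine functions to affine functions. -/
def jumpLin (F : Finset (Space d)) : T.BrokenP1 →ₗ[ℝ] (Space d →ᵃ[ℝ] ℝ) :=
  if h : ∃ p, T.IsSides F p then T.restrictLin h.choose.1 - T.restrictLin h.choose.2
  else if h : ∃ κ : T.elements, F ⊆ κ.1 then T.restrictLin h.choose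
  else 0

theorem jump_eq (F : Finset (Space d)) (v : T.BrokenP1) (x : Space d) :
    T.jump F v x = T.jumpLin F v x := by
  unfold jump jumpLin
  split_ifs <;> simp [restrictLin]

variable {T}

variable {κ κ' : T.elements} {F : Finset (Space d)} {Γ : Set (Space d)}

theorem exists_jumpLin_eq_sub (h : ∃ p, T.IsSides F p) :
    ∃ p, T.IsSides F p ∧ ∀ v, T.jumpLin F v = v p.1 - v p.2 :=
  ⟨h.choose, h.choose_spec, fun v => by simp [jumpLin, restrictLin, h]⟩

theorem jumpLin_eq_of_not_isSides (h : ¬ ∃ p, T.IsSides F p) (hκ : F ⊆ κ.1) (v : T.BrokenP1) :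
    T.jumpLin F v = v κ := by
  have h' : ∃ κ : T.elements, F ⊆ κ.1 := ⟨κ, hκ⟩
  have heq : h'.choose = κ := by
    by_contra hne
    exact h ⟨(h'.choose, κ), hne, h'.choose_spec, hκ⟩
  simp only [jumpLin, restrictLin, dif_neg h, dif_pos h', LinearMap.proj_apply, heq]

open Classical in
theorem mem_elementFaces_of_mem (hF : F ∈ T.interiorFaces ∪ T.facesIn Γ) :
    F ∈ T.elementFaces := by
  rcases Finset.mem_union.1 hF with h | h
  · exact (Finset.mem_filter.1 h).1
  · exact (Finset.mem_filter.1 h).1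

theorem mem_interiorFaces : F ∈ T.interiorFaces ↔ F ∈ T.elementFaces ∧ ∃ p, T.IsSides F p := by
  classical
  simp [interiorFaces]

theorem mem_facesIn :
    F ∈ T.facesIn Γ ↔ F ∈ T.elementFaces ∧ intrinsicInterior ℝ (hull F) ⊆ Γ := by
  classical
  simp [facesIn]

theorem faceIntegral_jump_eq_zero_iff (hF : F ∈ T.elementFaces) (v : T.BrokenP1) :
    faceIntegral F (T.jump F v) = 0 ↔ ∑ x ∈ F, T.jumpLin F v x = 0 := by
  have h1 : T.jump F v = T.jumpLin F v := funext (T.jump_eq F v)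
  have hi := elementFace_indep hF
  have hc := elementFace_card hF
  have hpos : (μHE[d - 1] : Measure (Space d)).real (hull F) ≠ 0 := by
    rw [measureReal_def]
    exact (ENNReal.toReal_pos (surfaceMeasure_pos hi hc).ne'
      (surfaceMeasure_lt_top hi hc).ne).ne'
  have hcard : (F.card : ℝ) ≠ 0 := by rw [hc]; positivity
  rw [h1, faceIntegral, setIntegral_surface_affineMap hi hc]
  simp [hpos, hcard]

open Classical in
/-- The mean value of an affine function on a face is the average of its values at the vertices, so
that the constraints of the Crouzeix–Raviart space only involve vertex values. -/
theorem mem_crouzeixRaviart {v : T.BrokenP1} :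
    v ∈ T.crouzeixRaviart Γ ↔
      ∀ F ∈ T.interiorFaces ∪ T.facesIn Γ, ∑ x ∈ F, T.jumpLin F v x = 0 :=
  forall₂_congr fun _ hF => faceIntegral_jump_eq_zero_iff (mem_elementFaces_of_mem hF) v

variable (T) in
/-- The Crouzeix–Raviart space as a linear subspace. -/
def crSubmodule (Γ : Set (Space d)) : Submodule ℝ T.BrokenP1 where
  carrier := T.crouzeixRaviart Γ
  zero_mem' := mem_crouzeixRaviart.2 fun F _ => by simp
  add_mem' {u v} hu hv := mem_crouzeixRaviart.2 fun F hF => by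
    simp [Finset.sum_add_distrib, mem_crouzeixRaviart.1 hu F hF, mem_crouzeixRaviart.1 hv F hF]
  smul_mem' c v hv := mem_crouzeixRaviart.2 fun F hF => by
    simp [← Finset.mul_sum, mem_crouzeixRaviart.1 hv F hF]

theorem mem_crSubmodule {v : T.BrokenP1} : v ∈ T.crSubmodule Γ ↔ v ∈ T.crouzeixRaviart Γ :=
  Iff.rfl

/-! ### The forms -/

theorem aForm_eq (u w : T.BrokenP1) :
    T.aForm u w =
      ∑ κ : T.elements, volume.real (hull κ.1) * inner ℝ (gradLin d (u κ)) (gradLin d (w κ)) := by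
  refine Finset.sum_congr rfl fun κ _ => ?_
  simp_rw [gradient_affineMap]
  rw [setIntegral_const, smul_eq_mul]

variable (T) in
/-- The form `a_h` as a bilinear map. -/
def aLin : T.BrokenP1 →ₗ[ℝ] T.BrokenP1 →ₗ[ℝ] ℝ :=
  LinearMap.mk₂ ℝ T.aForm
    (fun u u' w => by
      simp only [aForm_eq, Pi.add_apply, map_add, inner_add_left, mul_add,
        Finset.sum_add_distrib])
    (fun c u w => by
      simp only [aForm_eq, Pi.smul_apply, map_smul, real_inner_smul_left, smul_eq_mul,
        Finset.mul_sum]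
      exact Finset.sum_congr rfl fun κ _ => by ring)
    (fun u w w' => by
      simp only [aForm_eq, Pi.add_apply, map_add, inner_add_right, mul_add,
        Finset.sum_add_distrib])
    (fun c u w => by
      simp only [aForm_eq, Pi.smul_apply, map_smul, real_inner_smul_right, smul_eq_mul,
        Finset.mul_sum]
      exact Finset.sum_congr rfl fun κ _ => by ring)

theorem aLin_apply (u w : T.BrokenP1) : T.aLin u w = T.aForm u w := rfl

theorem aForm_comm (u w : T.BrokenP1) : T.aForm u w = T.aForm w u := by
  simp only [aForm_eq, real_inner_comm]

theorem gradForm_eq (γ : ℝ) (z w : T.BrokenP1) : T.gradForm γ z w = γ * T.aForm z w := by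
  rw [gradForm, aForm, Finset.mul_sum]
  exact Finset.sum_congr rfl fun κ _ => integral_const_mul _ _

theorem aForm_self_nonneg (z : T.BrokenP1) : 0 ≤ T.aForm z z := by
  rw [aForm_eq]
  exact Finset.sum_nonneg fun κ _ => mul_nonneg measureReal_nonneg real_inner_self_nonneg

theorem gradLin_eq_zero_of_aForm_self {z : T.BrokenP1} (h : T.aForm z z = 0) (κ : T.elements) :
    gradLin d (z κ) = 0 := by
  rw [aForm_eq, Finset.sum_eq_zero_iff_of_nonneg
    fun κ _ => mul_nonneg measureReal_nonneg real_inner_self_nonneg] at h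
  exact inner_self_eq_zero.1
    ((mul_eq_zero.1 (h κ (Finset.mem_univ κ))).resolve_left (volume_hull_pos κ).ne')

theorem integrableOn_jump_mul_jump (hF : F ∈ T.elementFaces) (u v : T.BrokenP1) :
    IntegrableOn (fun x => T.jumpLin F u x * T.jumpLin F v x) (hull F)
      (μHE[d - 1] : Measure (Space d)) :=
  integrableOn_surface (elementFace_indep hF) (elementFace_card hF)
    ((T.jumpLin F u).continuous_of_finiteDimensional.mul
      (T.jumpLin F v).continuous_of_finiteDimensional)

open Classical in
theorem jumpForm_eq (γ : ℝ) (u v : T.BrokenP1) :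
    T.jumpForm Γ γ u v = ∑ F ∈ T.interiorFaces ∪ T.facesIn Γ,
      γ * (Metric.diam (hull F))⁻¹ *
        faceIntegral F fun x => T.jumpLin F u x * T.jumpLin F v x := by
  refine Finset.sum_congr rfl fun F _ => ?_
  simp only [faceIntegral, jump_eq, mul_assoc]
  rw [integral_const_mul, integral_const_mul]

variable (T) in
/-- The jump penalty as a bilinear map. -/
def jumpFormLin (Γ : Set (Space d)) (γ : ℝ) : T.BrokenP1 →ₗ[ℝ] T.BrokenP1 →ₗ[ℝ] ℝ :=
  LinearMap.mk₂ ℝ (T.jumpForm Γ γ)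
    (fun u u' w => by
      simp only [jumpForm_eq, ← Finset.sum_add_distrib, ← mul_add]
      refine Finset.sum_congr rfl fun F hF => congrArg _ ?_
      have hF' := mem_elementFaces_of_mem hF
      simp only [faceIntegral, map_add, AffineMap.coe_add, Pi.add_apply, add_mul]
      exact integral_add (integrableOn_jump_mul_jump hF' u w) (integrableOn_jump_mul_jump hF' u' w))
    (fun c u w => by
      simp only [jumpForm_eq, smul_eq_mul, Finset.mul_sum]
      refine Finset.sum_congr rfl fun F hF => ?_
      simp only [faceIntegral, map_smul, AffineMap.coe_smul, Pi.smul_apply, smul_eq_mul, mul_assoc]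
      rw [integral_const_mul]
      ring)
    (fun u w w' => by
      simp only [jumpForm_eq, ← Finset.sum_add_distrib, ← mul_add]
      refine Finset.sum_congr rfl fun F hF => congrArg _ ?_
      have hF' := mem_elementFaces_of_mem hF
      simp only [faceIntegral, map_add, AffineMap.coe_add, Pi.add_apply, mul_add]
      exact integral_add (integrableOn_jump_mul_jump hF' u w) (integrableOn_jump_mul_jump hF' u w'))
    (fun c u w => by
      simp only [jumpForm_eq, smul_eq_mul, Finset.mul_sum]
      refine Finset.sum_congr rfl fun F hF => ?_
      simp only [faceIntegral, map_smul, AffineMap.coe_smul, Pi.smul_apply, smul_eq_mul,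
        mul_left_comm _ c]
      rw [integral_const_mul]
      exact mul_left_comm _ _ _)

theorem jumpFormLin_apply (γ : ℝ) (u w : T.BrokenP1) :
    T.jumpFormLin Γ γ u w = T.jumpForm Γ γ u w := rfl

theorem faceIntegral_mul_self_nonneg (F : Finset (Space d)) (g : Space d → ℝ) :
    0 ≤ faceIntegral F fun x => g x * g x :=
  integral_nonneg fun x => mul_self_nonneg (g x)

theorem jumpForm_self_nonneg {γ : ℝ} (hγ : 0 < γ) (u : T.BrokenP1) :
    0 ≤ T.jumpForm Γ γ u u := by
  rw [jumpForm_eq]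
  exact Finset.sum_nonneg fun F _ => mul_nonneg
    (mul_nonneg hγ.le (inv_nonneg.2 Metric.diam_nonneg)) (faceIntegral_mul_self_nonneg F _)

theorem diam_hull_pos (hd : 2 ≤ d) (hF : F ∈ T.elementFaces) : 0 < Metric.diam (hull F) := by
  have hc := (T.mem_elementFaces.1 hF).2
  obtain ⟨x, hx, y, hy, hxy⟩ := Finset.one_lt_card.1 (show 1 < F.card by omega)
  have hK : IsCompact (hull F) := F.finite_toSet.isCompact_convexHull ℝ
  exact (dist_pos.2 hxy).trans_le (Metric.dist_le_diam_of_mem hK.isBounded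
    (subset_convexHull ℝ _ hx) (subset_convexHull ℝ _ hy))

open Classical in
/-- A function with vanishing jump penalty has pointwise vanishing jumps. -/
theorem jumpLin_eq_zero_of_jumpForm_self (hd : 2 ≤ d) {γ : ℝ} (hγ : 0 < γ) {u : T.BrokenP1}
    (h : T.jumpForm Γ γ u u = 0) (hF : F ∈ T.interiorFaces ∪ T.facesIn Γ) {x : Space d}
    (hx : x ∈ hull F) : T.jumpLin F u x = 0 := by
  have hnn : ∀ F ∈ T.interiorFaces ∪ T.facesIn Γ, 0 ≤ γ * (Metric.diam (hull F))⁻¹ *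
      faceIntegral F fun x => T.jumpLin F u x * T.jumpLin F u x := fun F _ => mul_nonneg
    (mul_nonneg hγ.le (inv_nonneg.2 Metric.diam_nonneg)) (faceIntegral_mul_self_nonneg F _)
  rw [jumpForm_eq, Finset.sum_eq_zero_iff_of_nonneg hnn] at h
  have hF' := mem_elementFaces_of_mem hF
  have h0 := (mul_eq_zero.1 (h F hF)).resolve_left
    (mul_pos hγ (inv_pos.2 (diam_hull_pos hd hF'))).ne'
  exact eq_zero_of_setIntegral_surface_sq (elementFace_indep hF') (elementFace_card hF') _ h0 hx

/-! ### Crouzeix–Raviart basis functions -/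

open Classical in
variable (T) in
/-- The Crouzeix–Raviart basis function of the face `F`: on the elements containing `F` it has mean
value one on `F` and mean value zero on the other faces; elsewhere it vanishes. -/
def crFun (F : Finset (Space d)) : T.BrokenP1 := fun κ =>
  if F ⊆ κ.1 then AffineMap.const ℝ (Space d) 1 - (d : ℝ) • T.faceCoord κ F else 0

open Classical in
/-- The vertex sums of a basis function; by `mem_crouzeixRaviart` they stand for the mean values on
the faces. -/
theorem sum_crFun {G : Finset (Space d)} (hF : F ∈ T.elementFaces) (hG : G ∈ T.elementFaces)
    (hGκ : G ⊆ κ.1) : ∑ x ∈ G, T.crFun F κ x = if G = F then (d : ℝ) else 0 := by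
  have hGc := (T.mem_elementFaces.1 hG).2
  by_cases hFκ : F ⊆ κ.1
  · have h1 : ∀ x, T.crFun F κ x = 1 - d * T.faceCoord κ F x := fun x => by
      simp [crFun, hFκ]
    simp_rw [h1]
    rw [Finset.sum_sub_distrib, ← Finset.mul_sum]
    split_ifs with hGF
    · subst hGF
      rw [Finset.sum_eq_zero fun x hx => faceCoord_apply_of_mem hGκ hx]
      simp [hGc]
    · obtain ⟨a, ha, hκ⟩ := exists_apex hF hFκ
      have haG : a ∈ G := by
        by_contra haG
        refine hGF (Finset.eq_of_subset_of_card_le (fun x hx => ?_)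
          (by rw [hGc, (T.mem_elementFaces.1 hF).2]))
        rcases Finset.mem_insert.1 (hκ ▸ hGκ hx) with rfl | h
        · exact absurd hx haG
        · exact h
      have hsum : ∑ x ∈ G, T.faceCoord κ F x = 1 := by
        rw [← faceCoord_apply_of_notMem (hGκ haG) ha]
        refine Finset.sum_eq_single a (fun x hx hxa => faceCoord_apply_of_mem hFκ ?_)
          (fun h => absurd haG h)
        exact (Finset.mem_insert.1 (hκ ▸ hGκ hx)).resolve_left hxa
      simp [hsum, hGc]
  · have hGF : G ≠ F := fun h => hFκ (h ▸ hGκ)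
    simp [crFun, hFκ, hGF]

/-- The only constraint that the basis function of `F` could violate is the one on `F` itself. If `F`
is an interior face, the mean values from the two sides cancel in the jump. -/
theorem crFun_mem (hF : F ∈ T.elementFaces) (h : F ∈ T.interiorFaces ∨ F ∉ T.facesIn Γ) :
    T.crFun F ∈ T.crouzeixRaviart Γ := by
  classical
  refine mem_crouzeixRaviart.2 fun G hG => ?_
  have hG' := mem_elementFaces_of_mem hG
  by_cases hs : ∃ p, T.IsSides G p
  · obtain ⟨p, ⟨-, h1, h2⟩, hp⟩ := exists_jumpLin_eq_sub hs
    simp only [hp, AffineMap.coe_sub, Pi.sub_apply, Finset.sum_sub_distrib]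
    rw [sum_crFun hF hG' h1, sum_crFun hF hG' h2, sub_self]
  · obtain ⟨κ, hκ⟩ := exists_element_superset (T.mem_elementFaces.1 hG').1
    have hGi : G ∉ T.interiorFaces := fun h => hs (mem_interiorFaces.1 h).2
    have hGΓ := (Finset.mem_union.1 hG).resolve_left hGi
    rw [jumpLin_eq_of_not_isSides hs hκ, sum_crFun hF hG' hκ, if_neg]
    rintro rfl
    exact h.elim hGi fun h => h hGΓ

theorem gradLin_const (c : ℝ) : gradLin d (AffineMap.const ℝ (Space d) c) = 0 :=
  (gradLin_eq_zero_iff _).2 fun _ _ => rfl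

open Classical in
/-- Testing with a basis function sums up the derivatives of `v` normal to `F` in the elements
containing `F`. -/
theorem aForm_crFun (v : T.BrokenP1) (F : Finset (Space d)) :
    T.aForm v (T.crFun F) = -d * ∑ κ : T.elements, if F ⊆ κ.1 then
      volume.real (hull κ.1) * inner ℝ (gradLin d (v κ)) (gradLin d (T.faceCoord κ F)) else 0 := by
  rw [aForm_eq, Finset.mul_sum]
  refine Finset.sum_congr rfl fun κ _ => ?_
  by_cases h : F ⊆ κ.1
  · simp only [crFun, if_pos h, map_sub, gradLin_const, map_smul, zero_sub, inner_neg_right,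
      real_inner_smul_right]
    ring
  · simp [crFun, h]

theorem gradLin_faceCoord_ne_zero (hF : F ∈ T.elementFaces) (hFκ : F ⊆ κ.1) :
    gradLin d (T.faceCoord κ F) ≠ 0 := by
  classical
  intro h
  obtain ⟨a, ha, hκ⟩ := exists_apex hF hFκ
  obtain ⟨x, hx⟩ := elementFace_nonempty hF
  have h1 := (gradLin_eq_zero_iff _).1 h a x
  rw [faceCoord_apply_of_mem hFκ hx,
    faceCoord_apply_of_notMem (by rw [hκ]; exact Finset.mem_insert_self _ _) ha] at h1
  exact one_ne_zero h1

/-! ### Discrete unique continuation -/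

/-- If the jump over an interior face vanishes and `v` is `a_h`-orthogonal to the basis function of
the face, then both the tangential and the normal derivative of `v` are continuous across the
face, so `v` is the same affine function on both sides. -/
theorem eq_of_aForm_crFun (hd : d ≠ 0) (hF : F ∈ T.elementFaces) (hne : κ ≠ κ') (hFκ : F ⊆ κ.1)
    (hFκ' : F ⊆ κ'.1) {v : T.BrokenP1} (hv : ∀ x ∈ F, v κ x = v κ' x)
    (ha : T.aForm v (T.crFun F) = 0) : v κ = v κ' := by
  classical
  obtain ⟨a, haF, hκ⟩ := exists_apex hF hFκ
  obtain ⟨b, hbF, hκ'⟩ := exists_apex hF hFκ'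
  have haκ : a ∈ κ.1 := by rw [hκ]; exact Finset.mem_insert_self _ _
  have hbκ' : b ∈ κ'.1 := by rw [hκ']; exact Finset.mem_insert_self _ _
  have hs := faceCoord_neg hF hne hFκ hFκ' hbκ' hbF
  have hℓ := faceCoord_eq_smul hF hFκ hFκ' hbκ' hbF
  have hvol := volume_hull_eq hF hFκ hFκ' hbκ' hbF
  rw [abs_of_neg hs] at hvol
  have hvan : ∀ x ∈ F, (v κ - v κ') x = 0 := fun x hx => by
    rw [AffineMap.coe_sub, Pi.sub_apply, hv x hx, sub_self]
  have hjump := eq_smul_faceCoord hF hFκ hvan haκ haF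
  rw [aForm_crFun, Fintype.sum_eq_add κ κ' hne (fun κ'' h => if_neg fun h' => ?_),
    if_pos hFκ, if_pos hFκ', hvol] at ha
  · have hgrad := congrArg (gradLin d) hℓ
    rw [map_smul] at hgrad
    have hgj := congrArg (gradLin d) hjump
    rw [map_sub, map_smul] at hgj
    -- the two contributions combine to the normal component of the gradient jump
    have h1 : volume.real (hull κ.1) *
        inner ℝ (gradLin d (v κ) - gradLin d (v κ')) (gradLin d (T.faceCoord κ F)) = 0 := by
      have h2 := (mul_eq_zero.1 ha).resolve_left (neg_ne_zero.2 (Nat.cast_ne_zero.2 hd))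
      rw [inner_sub_left]
      have h3 : inner ℝ (gradLin d (v κ')) (gradLin d (T.faceCoord κ F)) =
          T.faceCoord κ F b * inner ℝ (gradLin d (v κ')) (gradLin d (T.faceCoord κ' F)) := by
        rw [← real_inner_smul_right, ← hgrad]
      rw [h3]
      linear_combination h2
    have h2 := (mul_eq_zero.1 h1).resolve_left (volume_hull_pos κ).ne'
    rw [hgj, real_inner_smul_left] at h2
    have h3 := (mul_eq_zero.1 h2).resolve_right
      (inner_self_ne_zero.2 (gradLin_faceCoord_ne_zero hF hFκ))
    rw [h3, zero_smul] at hjump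
    exact sub_eq_zero.1 hjump
  · rcases eq_or_eq_of_subset hF hne hFκ hFκ' h' with rfl | rfl
    · exact h.1 rfl
    · exact h.2 rfl

/-- A vanishing jump means equal traces from both sides, whichever order of the sides is fixed in the
definition of the jump. -/
theorem eq_on_face_of_jumpLin (hF : F ∈ T.elementFaces) (hne : κ ≠ κ') (hFκ : F ⊆ κ.1)
    (hFκ' : F ⊆ κ'.1) {v : T.BrokenP1} (hj : ∀ x ∈ F, T.jumpLin F v x = 0) :
    ∀ x ∈ F, v κ x = v κ' x := by
  intro x hx
  obtain ⟨⟨p, q⟩, ⟨hpq, h1, h2⟩, hp⟩ := exists_jumpLin_eq_sub ⟨(κ, κ'), hne, hFκ, hFκ'⟩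
  have h := hj x hx
  rw [hp, AffineMap.coe_sub, Pi.sub_apply, sub_eq_zero] at h
  dsimp only at hpq h1 h2 h
  rcases eq_or_eq_of_subset hF hne hFκ hFκ' h1 with rfl | rfl <;>
    rcases eq_or_eq_of_subset hF hne hFκ hFκ' h2 with rfl | rfl
  · exact absurd rfl hpq
  · exact h
  · exact h.symm
  · exact absurd rfl hpq

/-- A face in the boundary is not an interior face. -/
theorem not_isSides_of_subset_frontier (hΩo : IsOpen Ω) (hΩc : Convex ℝ Ω)
    (hF : F ∈ T.elementFaces) (hfr : hull F ⊆ frontier Ω) : ¬ ∃ p, T.IsSides F p := by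
  rintro ⟨p, hne, h1, h2⟩
  exact not_hull_subset_frontier hΩo hΩc hF hne h1 h2 hfr

/-- Discrete unique continuation: a continuous piecewise affine function that is `a_h`-orthogonal
to the Crouzeix–Raviart space and vanishes on one boundary face on which this space carries no
boundary condition is zero. By orthogonality the function is affine on the whole domain, and its
trace and its normal derivative vanish on the boundary face. -/
theorem eq_zero_of_aForm_eq_zero (hd : d ≠ 0) (hΩo : IsOpen Ω) (hΩc : Convex ℝ Ω)
    {v : T.BrokenP1} (hj : ∀ F ∈ T.interiorFaces, ∀ x ∈ F, T.jumpLin F v x = 0)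
    (hF : F ∈ T.elementFaces) (hfr : hull F ⊆ frontier Ω)
    (hFj : ∀ x ∈ F, T.jumpLin F v x = 0) (hFΓ : F ∉ T.facesIn Γ)
    (ha : ∀ w ∈ T.crouzeixRaviart Γ, T.aForm v w = 0) : v = 0 := by
  classical
  obtain ⟨κ, hFκ⟩ := exists_element_superset (T.mem_elementFaces.1 hF).1
  have hns := not_isSides_of_subset_frontier hΩo hΩc hF hfr
  have hκ0 : v κ = 0 := by
    obtain ⟨a, haF, hκ⟩ := exists_apex hF hFκ
    have haκ : a ∈ κ.1 := by rw [hκ]; exact Finset.mem_insert_self _ _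
    rw [jumpLin_eq_of_not_isSides hns hFκ] at hFj
    have hv := eq_smul_faceCoord hF hFκ hFj haκ haF
    have h1 := ha _ (crFun_mem hF (Or.inr hFΓ))
    rw [aForm_crFun, Fintype.sum_eq_single κ
      (fun κ' h => if_neg fun h' => hns ⟨(κ', κ), h, h', hFκ⟩), if_pos hFκ, hv, map_smul,
      real_inner_smul_left] at h1
    have h2 := (mul_eq_zero.1 h1).resolve_left (neg_ne_zero.2 (Nat.cast_ne_zero.2 hd))
    have h3 := (mul_eq_zero.1 h2).resolve_left (volume_hull_pos κ).ne'
    have h4 := (mul_eq_zero.1 h3).resolve_right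
      (inner_self_ne_zero.2 (gradLin_faceCoord_ne_zero hF hFκ))
    rw [hv, h4, zero_smul]
  funext κ'
  rw [Pi.zero_apply, ← hκ0]
  refine eq_of_forall_shared_face hd hΩc v (fun G hG κ₁ κ₂ h₁ h₂ => ?_) κ' κ
  rcases eq_or_ne κ₁ κ₂ with rfl | hne
  · rfl
  have hGi : G ∈ T.interiorFaces := mem_interiorFaces.2 ⟨hG, (κ₁, κ₂), hne, h₁, h₂⟩
  exact eq_of_aForm_crFun hd hG hne h₁ h₂ (eq_on_face_of_jumpLin hG hne h₁ h₂ (hj G hGi))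
    (ha _ (crFun_mem hG (Or.inl hGi)))

/-- A piecewise constant function whose jump over a face has mean value zero has no jump there. -/
theorem jumpLin_eq_zero_of_gradLin (hF : F ∈ T.elementFaces) {z : T.BrokenP1}
    (hz : ∀ κ, gradLin d (z κ) = 0) (hm : ∑ x ∈ F, T.jumpLin F z x = 0) :
    ∀ x ∈ F, T.jumpLin F z x = 0 := by
  intro x hx
  have hg : gradLin d (T.jumpLin F z) = 0 := by
    by_cases hs : ∃ p, T.IsSides F p
    · obtain ⟨p, -, hp⟩ := exists_jumpLin_eq_sub hs
      rw [hp, map_sub, hz, hz, sub_zero]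
    · obtain ⟨κ, hκ⟩ := exists_element_superset (T.mem_elementFaces.1 hF).1
      rw [jumpLin_eq_of_not_isSides hs hκ, hz]
  rw [Finset.sum_congr rfl fun y _ => (gradLin_eq_zero_iff _).1 hg y x, Finset.sum_const,
    nsmul_eq_mul] at hm
  exact (mul_eq_zero.1 hm).resolve_left
    (Nat.cast_ne_zero.2 (elementFace_nonempty hF).card_pos.ne')

end Mesh

/-! ### Square linear systems -/

/-- A saddle point system on `V × W`, tested with `W × V`, is a square linear system and thus
uniquely solvable as soon as the homogeneous system has only the trivial solution. -/
theorem existsUnique_saddlePoint {X : Type*} [AddCommGroup X] [Module ℝ X]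
    [FiniteDimensional ℝ X] (V W : Submodule ℝ X) (a sV sW : X →ₗ[ℝ] X →ₗ[ℝ] ℝ) (l : X →ₗ[ℝ] ℝ)
    (h : ∀ u ∈ V, ∀ z ∈ W, (∀ w ∈ W, a u w - sW z w = 0) → (∀ v ∈ V, a v z + sV u v = 0) →
      u = 0 ∧ z = 0) :
    ∃! p : X × X, p.1 ∈ V ∧ p.2 ∈ W ∧ (∀ w ∈ W, a p.1 w - sW p.2 w = l w) ∧
      ∀ v ∈ V, a v p.2 + sV p.1 v = 0 := by
  let A : (V × W) →ₗ[ℝ] (W →ₗ[ℝ] ℝ) × (V →ₗ[ℝ] ℝ) :=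
    { toFun := fun p => ((a p.1 - sW p.2).comp W.subtype,
        (a.flip p.2 + sV p.1).comp V.subtype)
      map_add' := fun p q => by
        ext x
        · simp; ring
        · simp; ring
      map_smul' := fun c p => by
        ext x
        · simp; ring
        · simp; ring }
  have hA1 : ∀ p w, (A p).1 w = a p.1 w - sW p.2 w := fun p w => rfl
  have hA2 : ∀ p v, (A p).2 v = a v p.2 + sV p.1 v := fun p v => rfl
  have hinj : Function.Injective A := by
    rw [injective_iff_map_eq_zero]
    rintro ⟨u, z⟩ hp
    obtain ⟨h1, h2⟩ := h u u.2 z z.2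
      (fun w hw => by rw [← hA1 (u, z) ⟨w, hw⟩, hp]; rfl)
      (fun v hv => by rw [← hA2 (u, z) ⟨v, hv⟩, hp]; rfl)
    exact Prod.ext (Subtype.ext h1) (Subtype.ext h2)
  have hfr : Module.finrank ℝ (V × W) =
      Module.finrank ℝ ((W →ₗ[ℝ] ℝ) × (V →ₗ[ℝ] ℝ)) := by
    have h1 : Module.finrank ℝ (V →ₗ[ℝ] ℝ) = Module.finrank ℝ V :=
      Subspace.dual_finrank_eq
    have h2 : Module.finrank ℝ (W →ₗ[ℝ] ℝ) = Module.finrank ℝ W :=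
      Subspace.dual_finrank_eq
    rw [Module.finrank_prod, Module.finrank_prod, h1, h2, add_comm]
  obtain ⟨⟨u, z⟩, hp⟩ := (LinearMap.injective_iff_surjective_of_finrank_eq_finrank hfr).1 hinj
    (l.comp W.subtype, 0)
  refine ⟨(u, z), ⟨u.2, z.2, fun w hw => ?_, fun v hv => ?_⟩, ?_⟩
  · rw [← hA1 (u, z) ⟨w, hw⟩, hp]; rfl
  · rw [← hA2 (u, z) ⟨v, hv⟩, hp]; rfl
  · rintro ⟨u', z'⟩ ⟨hu, hz, h1, h2⟩
    have : A (⟨u', hu⟩, ⟨z', hz⟩) = A (u, z) := by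
      rw [hp]
      exact Prod.ext (LinearMap.ext fun w => h1 w w.2) (LinearMap.ext fun v => h2 v v.2)
    have := hinj this
    exact Prod.ext (congrArg (fun q => (q.1 : X)) this) (congrArg (fun q => (q.2 : X)) this)

namespace Mesh

variable {d : ℕ} {Ω : Set (Space d)} {T : Mesh Ω} {ΓC ΓD Γ : Set (Space d)}

/-! ### The load functional -/

/-- A square integrable function on `Ω` can be integrated over an element against affine functions.
An element lies in the closure of `Ω`, and the boundary of the convex set `Ω` is a null set. -/
theorem integrableOn_hull_mul (hΩc : Convex ℝ Ω) {f : Space d → ℝ}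
    (hf : MemLp f 2 (volume.restrict Ω)) (κ : T.elements) (g : Space d →ᵃ[ℝ] ℝ) :
    IntegrableOn (fun x => f x * g x) (hull κ.1) := by
  have hg : Continuous g := g.continuous_of_finiteDimensional
  have hae : Ω =ᵐ[volume] closure Ω := by
    refine subset_closure.eventuallyLE.antisymm (ae_le_set.2 (measure_mono_null ?_
      (hΩc.addHaar_frontier volume)))
    exact sdiff_subset_sdiff_right interior_subset
  have h1 : MemLp f 2 (volume.restrict (hull κ.1)) := by
    rw [Measure.restrict_congr_set hae] at hf
    exact hf.mono_measure (Measure.restrict_mono_set _ (element_subset_closure κ))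
  have h2 : MemLp g 2 (volume.restrict (hull κ.1)) := by
    rw [memLp_two_iff_integrable_sq hg.aestronglyMeasurable]
    exact (hg.pow 2).continuousOn.integrableOn_compact (κ.1.finite_toSet.isCompact_convexHull ℝ)
  exact h1.integrable_mul h2

/-- The load functional is linear, because all the integrals in it converge. -/
theorem exists_loadLin (hΩc : Convex ℝ Ω) {f ψ : Space d → ℝ}
    (hf : MemLp f 2 (volume.restrict Ω))
    (hψ : MemLp ψ 2 ((μHE[d - 1] : Measure (Space d)).restrict ΓC)) :
    ∃ l : T.BrokenP1 →ₗ[ℝ] ℝ, ∀ w, l w = T.load ΓC f ψ w := by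
  have hface : ∀ F ∈ T.facesIn ΓC, ∀ g : Space d →ᵃ[ℝ] ℝ,
      IntegrableOn (fun x => ψ x * g x) (hull F) (μHE[d - 1] : Measure (Space d)) := by
    intro F hF g
    obtain ⟨hF', hsub⟩ := mem_facesIn.1 hF
    exact integrableOn_surface_mul (elementFace_indep hF') (elementFace_card hF') hsub hψ
      g.continuous_of_finiteDimensional
  refine ⟨{ toFun := T.load ΓC f ψ, map_add' := fun v w => ?_, map_smul' := fun c w => ?_ },
    fun w => rfl⟩
  · have h1 : ∀ κ : T.elements, ∫ x in hull κ.1, f x * (v + w) κ x =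
        (∫ x in hull κ.1, f x * v κ x) + ∫ x in hull κ.1, f x * w κ x := fun κ => by
      rw [← integral_add (integrableOn_hull_mul hΩc hf κ _) (integrableOn_hull_mul hΩc hf κ _)]
      simp only [Pi.add_apply, AffineMap.coe_add, mul_add]
    have h2 : ∀ F ∈ T.facesIn ΓC, (faceIntegral F fun x => ψ x * T.jump F (v + w) x) =
        (faceIntegral F fun x => ψ x * T.jump F v x) +
          faceIntegral F fun x => ψ x * T.jump F w x := fun F hF => by
      simp only [faceIntegral, jump_eq]
      rw [← integral_add (hface F hF _) (hface F hF _)]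
      simp only [map_add, AffineMap.coe_add, Pi.add_apply, mul_add]
    simp only [load]
    rw [Finset.sum_congr rfl h2, Finset.sum_congr rfl fun κ _ => h1 κ, Finset.sum_add_distrib,
      Finset.sum_add_distrib]
    ring
  · have h1 : ∀ κ : T.elements, ∫ x in hull κ.1, f x * (c • w) κ x =
        c * ∫ x in hull κ.1, f x * w κ x := fun κ => by
      rw [← integral_const_mul]
      simp only [Pi.smul_apply, AffineMap.coe_smul, smul_eq_mul, mul_left_comm c]
    have h2 : ∀ F ∈ T.facesIn ΓC, (faceIntegral F fun x => ψ x * T.jump F (c • w) x) =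
        c * faceIntegral F fun x => ψ x * T.jump F w x := fun F hF => by
      simp only [faceIntegral, jump_eq]
      rw [← integral_const_mul]
      simp only [map_smul, AffineMap.coe_smul, Pi.smul_apply, smul_eq_mul, mul_left_comm c]
    simp only [load]
    rw [Finset.sum_congr rfl h2, Finset.sum_congr rfl fun κ _ => h1 κ, ← Finset.mul_sum,
      ← Finset.mul_sum, ← mul_add]
    rfl

/-! ### Unique solvability of the stabilized formulation -/

theorem notMem_facesIn_of_disjoint {F : Finset (Space d)} (hF : F ∈ T.elementFaces)
    (h : Disjoint (intrinsicInterior ℝ (hull F)) Γ) : F ∉ T.facesIn Γ := fun hF' =>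
  (intrinsicInterior_hull_nonempty hF).ne_empty
    (disjoint_self.1 (h.mono_right (mem_facesIn.1 hF').2))

open Classical in
/-- Unique solvability for every adjoint stabilization `sW` that is positive semidefinite and
controls the jumps on `W_h`. -/
theorem existsUnique_isDiscreteSolution (hd : 2 ≤ d) (hΩo : IsOpen Ω) (hΩc : Convex ℝ Ω)
    (hCD : ΓC ⊆ ΓD) (hD : ΓD ⊆ frontier Ω)
    (hCpos : 0 < (μHE[d - 1] : Measure (Space d)) ΓC)
    (hD'pos : 0 < (μHE[d - 1] : Measure (Space d)) (frontier Ω \ ΓD))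
    (hTC : T.FittedTo ΓC) (hTD : T.FittedTo ΓD) {γV : ℝ} (hγV : 0 < γV)
    {f ψ : Space d → ℝ} (hf : MemLp f 2 (volume.restrict Ω))
    (hψ : MemLp ψ 2 ((μHE[d - 1] : Measure (Space d)).restrict ΓC))
    (sW : T.BrokenP1 →ₗ[ℝ] T.BrokenP1 →ₗ[ℝ] ℝ) (hsW : ∀ z, 0 ≤ sW z z)
    (hsW0 : ∀ z ∈ T.crouzeixRaviart (frontier Ω \ ΓC), sW z z = 0 → (∀ w, sW z w = 0) ∧
      ∀ F ∈ T.interiorFaces ∪ T.facesIn (frontier Ω \ ΓC), ∀ x ∈ F, T.jumpLin F z x = 0) :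
    ∃! p : T.BrokenP1 × T.BrokenP1,
      T.IsDiscreteSolution ΓD ΓC γV (fun z w => sW z w) f ψ p := by
  obtain ⟨l, hl⟩ := exists_loadLin (T := T) hΩc hf hψ
  have hd0 : d ≠ 0 := by omega
  have key := existsUnique_saddlePoint (T.crSubmodule ΓD) (T.crSubmodule (frontier Ω \ ΓC))
    T.aLin (T.jumpFormLin ΓD γV) sW l ?_
  · simpa only [mem_crSubmodule, hl, aLin_apply, jumpFormLin_apply, IsDiscreteSolution] using key
  intro u hu z hz h1 h2
  simp only [mem_crSubmodule, aLin_apply, jumpFormLin_apply] at hu hz h1 h2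
  -- testing with `(u, z)` itself shows that both stabilization terms vanish
  have e1 := h1 z hz
  have e2 := h2 u hu
  have n1 := hsW z
  have n2 := jumpForm_self_nonneg (T := T) (Γ := ΓD) hγV u
  obtain ⟨hz1, hz2⟩ := hsW0 z hz (by linarith)
  have hu0 : T.jumpForm ΓD γV u u = 0 := by linarith
  have hu1 : ∀ F ∈ T.interiorFaces ∪ T.facesIn ΓD, ∀ x ∈ F, T.jumpLin F u x = 0 :=
    fun F hF x hx => jumpLin_eq_zero_of_jumpForm_self hd hγV hu0 hF
      (subset_convexHull ℝ _ hx)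
  -- the test space carries no boundary condition on `ΓC`, where `u` vanishes
  have hu2 : u = 0 := by
    obtain ⟨F, hF, hfr, x, hx, hxC⟩ :=
      exists_boundaryFace (T := T) hd0 hΩo hΩc (hCD.trans hD) hCpos
    have hFC : intrinsicInterior ℝ (hull F) ⊆ ΓC :=
      (hTC F hF hfr).resolve_right fun h => disjoint_left.1 h hx hxC
    refine eq_zero_of_aForm_eq_zero (Γ := frontier Ω \ ΓC) hd0 hΩo hΩc
      (fun G hG => hu1 G (Finset.mem_union_left _ hG)) hF hfr
      (hu1 F (Finset.mem_union_right _ (mem_facesIn.2 ⟨hF, hFC.trans hCD⟩)))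
      (notMem_facesIn_of_disjoint hF (disjoint_sdiff_right.mono_left hFC)) fun w hw => ?_
    have := h1 w hw
    rw [hz1 w] at this
    linarith
  refine ⟨hu2, ?_⟩
  obtain ⟨F, hF, hfr, x, hx, hxD⟩ :=
    exists_boundaryFace (T := T) hd0 hΩo hΩc sdiff_subset hD'pos
  have hFD : Disjoint (intrinsicInterior ℝ (hull F)) ΓD :=
    (hTD F hF hfr).resolve_left fun h => hxD.2 (h hx)
  have hFC : F ∈ T.facesIn (frontier Ω \ ΓC) := mem_facesIn.2 ⟨hF, fun y hy =>
    ⟨hfr (intrinsicInterior_subset hy), fun hyC => disjoint_left.1 hFD hy (hCD hyC)⟩⟩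
  refine eq_zero_of_aForm_eq_zero (Γ := ΓD) hd0 hΩo hΩc
    (fun G hG => hz2 G (Finset.mem_union_left _ hG)) hF hfr
    (hz2 F (Finset.mem_union_right _ hFC)) (notMem_facesIn_of_disjoint hF hFD) fun v hv => ?_
  have h3 := h2 v hv
  have h4 : T.jumpForm ΓD γV u v = 0 := by
    rw [hu2, ← jumpFormLin_apply, map_zero, LinearMap.zero_apply]
  rw [aForm_comm]
  linarith

end Mesh

end CauchyFEM

end

theorem mainTheorem2 {d : ℕ} (hd : d = 2 ∨ d = 3)
    (Ω : Set (CauchyFEM.Space d)) (hΩo : IsOpen Ω) (hΩc : Convex ℝ Ω)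
    (T : CauchyFEM.Mesh Ω)
    (ΓC ΓD : Set (CauchyFEM.Space d)) (hCD : ΓC ⊆ ΓD) (hD : ΓD ⊆ frontier Ω)
    (hCpos : 0 < (μHE[d - 1] : Measure (CauchyFEM.Space d)) ΓC)
    (hDpos : 0 < (μHE[d - 1] : Measure (CauchyFEM.Space d)) ΓD)
    (hD'pos : 0 < (μHE[d - 1] : Measure (CauchyFEM.Space d)) (frontier Ω \ ΓD))
    (hTC : T.FittedTo ΓC) (hTD : T.FittedTo ΓD)
    (γV γW : ℝ) (hγV : 0 < γV) (hγW : 0 < γW)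
    (f ψ : CauchyFEM.Space d → ℝ) (hf : MemLp f 2 (volume.restrict Ω))
    (hψ : MemLp ψ 2 ((μHE[d - 1] : Measure (CauchyFEM.Space d)).restrict ΓC)) :
    (∃! p : T.BrokenP1 × T.BrokenP1,
      T.IsDiscreteSolution ΓD ΓC γV (T.gradForm γW) f ψ p) ∧
    (∃! p : T.BrokenP1 × T.BrokenP1,
      T.IsDiscreteSolution ΓD ΓC γV (T.jumpForm (frontier Ω \ ΓC) γW) f ψ p) := by
  have hd2 : 2 ≤ d := by omega
  constructor
  · have hform : T.gradForm γW = fun z w => (γW • T.aLin) z w := by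
      funext z w
      exact CauchyFEM.Mesh.gradForm_eq γW z w
    rw [hform]
    refine CauchyFEM.Mesh.existsUnique_isDiscreteSolution hd2 hΩo hΩc hCD hD hCpos hD'pos hTC hTD
      hγV hf hψ _ (fun z => mul_nonneg hγW.le (CauchyFEM.Mesh.aForm_self_nonneg z))
      fun z hz h0 => ?_
    have hz0 := CauchyFEM.Mesh.gradLin_eq_zero_of_aForm_self
      ((mul_eq_zero.1 h0).resolve_left hγW.ne')
    refine ⟨fun w => ?_, fun F hF => CauchyFEM.Mesh.jumpLin_eq_zero_of_gradLin
      (CauchyFEM.Mesh.mem_elementFaces_of_mem hF) hz0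
      (CauchyFEM.Mesh.mem_crouzeixRaviart.1 hz F hF)⟩
    change γW * T.aForm z w = 0
    simp [CauchyFEM.Mesh.aForm_eq, hz0]
  · refine CauchyFEM.Mesh.existsUnique_isDiscreteSolution hd2 hΩo hΩc hCD hD hCpos hD'pos hTC hTD
      hγV hf hψ (T.jumpFormLin (frontier Ω \ ΓC) γW)
      (CauchyFEM.Mesh.jumpForm_self_nonneg hγW) fun z hz h0 => ?_
    have hj := fun F hF x hx => CauchyFEM.Mesh.jumpLin_eq_zero_of_jumpForm_self
      (F := F) (x := x) hd2 hγW h0 hF hx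
    refine ⟨fun w => ?_, fun F hF x hx => hj F hF x (subset_convexHull ℝ _ hx)⟩
    rw [CauchyFEM.Mesh.jumpFormLin_apply, CauchyFEM.Mesh.jumpForm_eq]
    refine Finset.sum_eq_zero fun F hF => mul_eq_zero_of_right _ ?_
    refine setIntegral_eq_zero_of_forall_eq_zero fun x hx => ?_
    rw [hj F hF x hx, zero_mul]
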